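/- **Setting.** Let $d\ge 1$, let $\mathcal X,\mathcal A$ be measurable spaces and $\phi:\mathcal X\times\mathcal A\to\mathbb R^d$ measurable with $\|\phi\|_2\le 1$. A linear contextual bandit $\mathcal M=(q,\theta,\nu)$ consists of a context law $q$ on $\mathcal X$, a parameter $\theta\in\mathbb R^d$ with $\|\theta\|_2\le1$, and a zero-mean, $1$-sub-Gaussian noise law $\nu$. A policy $\pi\in\Pi$ is a Markov kernel from $\mathcal X$ to $\mathcal A$; an episode under $\pi$ is $x\sim q$, $a\sim\pi(\cdot|x)$, $r=\phi(x,a)^\top\theta+\xi$ with $\xi\sim\nu$ independent of $(x,a)$; and $V^\pi_{\mathcal M}=\mathbb E_{x\sim q,a\sim\pi(\cdot|x)}[\phi(x,a)^\top\theta]$. Let $\mathcal M^*=(q^*,\theta^*,\nu^*)$ be the true environment, $\pi^*$ an optimal policy for it, and $\mathcal D_0$ an offline dataset of $N_0$ i.i.d. episodes under a behavior policy $\rho$ in $\mathcal M^*$. **Concentrability.** Let $\kappa\ge1$, and for each $\pi$ let $\hat V^\pi_{\mathrm{Alg}_0}(\mathcal D_0)$ be an estimator whose worst-case error $\sup_{\mathcal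 M}\mathbb E_{\mathcal D_0\sim(\mathcal M,\rho)}|V^\pi_{\mathcal M}-\hat V^\pi_{\mathrm{Alg}_0}(\mathcal D_0)|$ over all linear contextual bandits $\mathcal M$ with feature map $\phi$ is at most $\kappa$ times that of every other measurable estimator ($\kappa=1$: exactly minimax). Put $\mathtt U(\pi)=\mathbb E_{\mathcal D_0\sim(\mathcal M^*,\rho)}|V^\pi_{\mathcal M^*}-\hat V^\pi_{\mathrm{Alg}_0}(\mathcal D_0)|$ and $\mathtt C(\pi|\rho)=(\mathtt U(\pi)/\mathtt U(\rho))^2\in[0,\infty]$ (with $0/0=0$). For $\varepsilon\ge0$ let $\mathtt C(\pi^{-\varepsilon}|\rho)\in[1,\infty]$ be the maximum of $1$ and $\sup\{\mathtt C(\pi|\rho):V^\pi_{\mathcal M^*}<V^{\pi^*}_{\mathcal M^*}-\varepsilon\}$. **Algorithm (hybrid Lin-UCB).** For $\delta\in(0,1)$ and $N=N_0+N_1$ let $\beta=\sqrt d\,\bigl(1+2\sqrt{\log((1+N)/\delta)}\bigr)$. For a dataset $\mathcal D$ let $\hat\Lambda=d\,I+\sum_{(x,a,r)\in\mathcal D}\phi(x,a)\phi(x,a)^\top$,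 $\hat\theta=\hat\Lambda^{-1}\sum_{(x,a,r)\in\mathcal D} r\,\phi(x,a)$, $\hat V^\pi(\mathcal D)=\mathbb E_{x\sim q^*,a\sim\pi}[\phi(x,a)^\top\hat\theta]$ and $\hat{\mathtt U}^\pi(\mathcal D)=\mathbb E_{x\sim q^*,a\sim\pi}[\beta\|\phi(x,a)\|_{\hat\Lambda^{-1}}]$. In online episode $t=1,\dots,N_1$ play $\pi_t\in\arg\max_{\pi}(\hat V^\pi+\hat{\mathtt U}^\pi)(\mathcal D_0\cup\mathcal D_{t-1})$, where $\mathcal D_{t-1}$ consists of the earlier online episodes; at the end output $\hat\pi\in\arg\max_\pi(\hat V^\pi-\hat{\mathtt U}^\pi)(\mathcal D_0\cup\mathcal D_{N_1})$. Let $\mathrm{Sub\text{-}opt}(\pi)=V^{\pi^*}_{\mathcal M^*}-V^{\pi}_{\mathcal M^*}$ and $\mathrm{Regret}(N_1)=\sum_{t=1}^{N_1}\mathrm{Sub\text{-}opt}(\pi_t)$. **Statement.** There are universal constants $c>0$ and $p\in\mathbb N$ such that the following holds in every such setting. Let $K\ge0$ be such that, with probability at least $1-\delta$ over $\mathcal D_0$,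 $\hat{\mathtt U}^\pi(\mathcal D_0)\le K d\,\mathtt U(\pi)$ for all $\pi\in\Pi$ (the framework's assumption on its oracle algorithm, with $C_{\mathtt{Alg}}=Kd$), and let $0\le\varepsilon$ and $\varepsilon\sqrt{N_0+N_1}\le\alpha$. Put $B=c\,(1+\alpha+\kappa K)\bigl(1+\log\tfrac{1+N_0+N_1}{\delta}\bigr)^p$. Then with probability at least $1-3\delta$, $$\mathrm{Regret}(N_1)\le B\,d\sqrt{N_1}\sqrt{\frac{N_1}{N_0/\mathtt C(\pi^{-\varepsilon}|\rho)+N_1}},$$ $$\mathrm{Sub\text{-}opt}(\hat\pi)\le B\,d\sqrt{\frac1{N_0/\mathtt C(\pi^*|\rho)+N_1}}\quad\text{and}\quad \mathrm{Sub\text{-}opt}(\hat\pi)\le B\,d\sqrt{\frac1{N_0/\mathtt C(\pi^{-\varepsilon}|\rho)+N_1}}.$$ (All expressions are read in $[0,\infty]$, with $0/0=0$ and $0/\infty=0$, and $y/0=\infty$ for $y>0$.) -/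

import Mathlib

open MeasureTheory ProbabilityTheory
open scoped ENNReal

namespace HybridBandit

noncomputable section

universe u v

/-- One episode of a contextual bandit: context, arm, reward. -/
abbrev Obs (X : Type u) (A : Type v) : Type (max u v) := X × A × ℝ

/-- A dataset of `n` episodes. -/
abbrev Dataset (X : Type u) (A : Type v) (n : ℕ) : Type (max u v) := Fin n → Obs X A

/-- Stochastic policies, i.e. Markov kernels from contexts to arms. -/
abbrev Policy (X : Type u) (A : Type v) [MeasurableSpace X] [MeasurableSpace A] :
    Type (max u v) :=
  {π : Kernel X A // IsMarkovKernel π}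

/-- A linear contextual bandit environment over a given feature map: context law `q`, parameter
`θ` in the unit ball, law of the (independent, centred, 1-sub-Gaussian) reward noise. -/
structure Env (X : Type u) [MeasurableSpace X] (d : ℕ) where
  q : Measure X
  q_prob : IsProbabilityMeasure q
  θ : EuclideanSpace ℝ (Fin d)
  θ_le : ‖θ‖ ≤ 1
  noise : Measure ℝ
  noise_prob : IsProbabilityMeasure noise
  noise_mean : ∫ z, z ∂noise = 0
  noise_subG : HasSubgaussianMGF id 1 noise

attribute [instance] Env.q_prob Env.noise_prob

variable {X : Type u} {A : Type v} [MeasurableSpace X] [MeasurableSpace A] {d : ℕ}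

instance (π : Policy X A) : IsMarkovKernel π.1 := π.2

/-- `(x, a)` together with the noise `ξ` gives the episode `(x, a, ⟨φ(x,a), θ⟩ + ξ)`. -/
def observe (φ : X × A → EuclideanSpace ℝ (Fin d)) (θ : EuclideanSpace ℝ (Fin d))
    (p : (X × A) × ℝ) : Obs X A :=
  (p.1.1, p.1.2, inner ℝ (φ p.1) θ + p.2)

/-- Law of one episode when policy `π` is played in environment `M`. -/
def episodeLaw (φ : X × A → EuclideanSpace ℝ (Fin d)) (M : Env X d) (π : Policy X A) :
    Measure (Obs X A) :=
  ((M.q ⊗ₘ π.1).prod M.noise).map (observe φ M.θ)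

/-- Value `V_M^π = E_{x ∼ q, a ∼ π(·|x)} ⟨φ(x,a), θ⟩`, the expected reward. -/
def value (φ : X × A → EuclideanSpace ℝ (Fin d)) (M : Env X d) (π : Policy X A) : ℝ :=
  ∫ p, inner ℝ (φ p) M.θ ∂(M.q ⊗ₘ π.1)

/-- Law of an offline dataset: `N₀` independent episodes under the behavior policy `ρ`. -/
def offlineLaw (φ : X × A → EuclideanSpace ℝ (Fin d)) (M : Env X d) (ρ : Policy X A) (N₀ : ℕ) :
    Measure (Dataset X A N₀) :=
  Measure.pi fun _ => episodeLaw φ M ρ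

/-! ### Uncertainty level and concentrability -/

/-- Value estimators from an offline dataset, one for every target policy. -/
abbrev Estimator (X : Type u) (A : Type v) [MeasurableSpace X] [MeasurableSpace A] (N₀ : ℕ) :
    Type (max u v) :=
  {f : Dataset X A N₀ → ℝ // Measurable f}

/-- `E_{D₀ ∼ (M, ρ)} |V_M^π - f(D₀)|`. -/
def risk (φ : X × A → EuclideanSpace ℝ (Fin d)) (ρ : Policy X A) {N₀ : ℕ} (M : Env X d)
    (π : Policy X A) (f : Estimator X A N₀) : ℝ≥0∞ :=
  ∫⁻ D, ENNReal.ofReal |value φ M π - f.1 D| ∂(offlineLaw φ M ρ N₀)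

/-- `max_M E_{D₀ ∼ (M, ρ)} |V_M^π - f(D₀)|`, over all linear contextual bandits `M`. -/
def worstRisk (φ : X × A → EuclideanSpace ℝ (Fin d)) (ρ : Policy X A) {N₀ : ℕ}
    (π : Policy X A) (f : Estimator X A N₀) : ℝ≥0∞ :=
  ⨆ M : Env X d, risk φ ρ M π f

/-- `alg₀` minimizes, for every target policy, the worst-case estimation error up to the
factor `κ`; for `κ = 1` it is a minimax oracle. -/
def IsMinimax (φ : X × A → EuclideanSpace ℝ (Fin d)) (ρ : Policy X A) {N₀ : ℕ} (κ : ℝ)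
    (alg₀ : Policy X A → Estimator X A N₀) : Prop :=
  ∀ (π : Policy X A) (f : Estimator X A N₀),
    worstRisk φ ρ π (alg₀ π) ≤ ENNReal.ofReal κ * worstRisk φ ρ π f

/-- Uncertainty level `U_M(π)`. -/
def uncertaintyLevel (φ : X × A → EuclideanSpace ℝ (Fin d)) (ρ : Policy X A) {N₀ : ℕ}
    (alg₀ : Policy X A → Estimator X A N₀) (M : Env X d) (π : Policy X A) : ℝ≥0∞ :=
  risk φ ρ M π (alg₀ π)

/-- Concentrability coefficient `C(π|ρ) = (U_M(π) / U_M(ρ))²`. -/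
def concentrability (φ : X × A → EuclideanSpace ℝ (Fin d)) (ρ : Policy X A) {N₀ : ℕ}
    (alg₀ : Policy X A → Estimator X A N₀) (M : Env X d) (π : Policy X A) : ℝ≥0∞ :=
  (uncertaintyLevel φ ρ alg₀ M π / uncertaintyLevel φ ρ alg₀ M ρ) ^ 2

/-- `C(π^{-ε}|ρ)`: the supremum, taken in `[1, ∞]`, of `C(π|ρ)` over all policies `π` whose
sub-optimality gap (relative to the optimal policy `πs`) exceeds `ε`. -/
def concentrabilitySubopt (φ : X × A → EuclideanSpace ℝ (Fin d)) (ρ : Policy X A) {N₀ : ℕ}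
    (alg₀ : Policy X A → Estimator X A N₀) (M : Env X d) (πs : Policy X A) (ε : ℝ) : ℝ≥0∞ :=
  max 1 (⨆ (π : Policy X A) (_ : value φ M π < value φ M πs - ε),
    concentrability φ ρ alg₀ M π)

/-! ### The hybrid framework -/

/-- An oracle algorithm: from a dataset, a value estimate and an uncertainty for each policy. -/
structure Oracle (X : Type u) (A : Type v) [MeasurableSpace X] [MeasurableSpace A] where
  estimate : {n : ℕ} → Dataset X A n → Policy X A → ℝ
  uncertainty : {n : ℕ} → Dataset X A n → Policy X A → ℝ

/-- An online algorithm: after `t` online episodes it maps the `N₀` offline and `t` online episodes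
and the current context to a law on arms. -/
abbrev OnlineAlg (X : Type u) (A : Type v) [MeasurableSpace X] [MeasurableSpace A] (N₀ : ℕ) :
    Type (max u v) :=
  (t : ℕ) → {κ : Kernel (Dataset X A (N₀ + t) × X) A // IsMarkovKernel κ}

instance {N₀ : ℕ} (alg : OnlineAlg X A N₀) (t : ℕ) : IsMarkovKernel (alg t).1 := (alg t).2

/-- The policy played after the dataset `D` (offline and online episodes) has been seen. -/
def OnlineAlg.policy {N₀ : ℕ} (alg : OnlineAlg X A N₀) (t : ℕ) (D : Dataset X A (N₀ + t)) :
    Policy X A :=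
  ⟨(alg t).1.comap (fun x => (D, x)) measurable_prodMk_left, inferInstance⟩

/-- Law of the next episode as a kernel in the past: `x ∼ q`, `a ∼ alg (D, x)`,
`r = ⟨φ(x,a), θ⟩ + ξ`. -/
def nextEpisode (φ : X × A → EuclideanSpace ℝ (Fin d)) (M : Env X d) {N₀ : ℕ}
    (alg : OnlineAlg X A N₀) (t : ℕ) : Kernel (Dataset X A (N₀ + t)) (Obs X A) :=
  ((Kernel.const _ M.q ⊗ₖ (alg t).1) ×ₖ Kernel.const _ M.noise).map (observe φ M.θ)

/-- Joint law of the `N₀` offline episodes followed by the first `t` online episodes. -/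
def runLaw (φ : X × A → EuclideanSpace ℝ (Fin d)) (M : Env X d) (ρ : Policy X A) {N₀ : ℕ}
    (alg : OnlineAlg X A N₀) : (t : ℕ) → Measure (Dataset X A (N₀ + t))
  | 0 => offlineLaw φ M ρ N₀
  | t + 1 => (runLaw φ M ρ alg t ⊗ₘ nextEpisode φ M alg t).map
      fun p => Fin.snoc (α := fun _ => Obs X A) p.1 p.2

/-- The dataset after the first `t ≤ N₁` online episodes of a run. -/
def past {N₀ N₁ : ℕ} (D : Dataset X A (N₀ + N₁)) (t : Fin N₁) : Dataset X A (N₀ + t) :=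
  fun i => D (Fin.castLE (Nat.add_le_add_left t.2.le N₀) i)

/-- Optimism: in each of the `N₁` rounds the policy played maximizes the upper confidence bound. -/
def IsOptimistic {N₀ : ℕ} (O : Oracle X A) (N₁ : ℕ) (alg : OnlineAlg X A N₀) : Prop :=
  ∀ t < N₁, ∀ (D : Dataset X A (N₀ + t)) (π : Policy X A),
    O.estimate D π + O.uncertainty D π ≤
      O.estimate D (alg.policy t D) + O.uncertainty D (alg.policy t D)

/-- Pessimism: the policy that is output maximizes the lower confidence bound. -/
def IsPessimistic {n : ℕ} (O : Oracle X A) (out : Dataset X A n → Policy X A) : Prop :=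
  ∀ (D : Dataset X A n) (π : Policy X A),
    O.estimate D π - O.uncertainty D π ≤ O.estimate D (out D) - O.uncertainty D (out D)

/-- Sub-optimality gap of `π` with respect to the optimal policy `πs`. -/
def gap (φ : X × A → EuclideanSpace ℝ (Fin d)) (M : Env X d) (πs π : Policy X A) : ℝ :=
  value φ M πs - value φ M π

/-- Regret of the `N₁` online rounds along a run. -/
def regret (φ : X × A → EuclideanSpace ℝ (Fin d)) (M : Env X d) (πs : Policy X A) {N₀ N₁ : ℕ}
    (alg : OnlineAlg X A N₀) (D : Dataset X A (N₀ + N₁)) : ℝ :=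
  ∑ t : Fin N₁, gap φ M πs (alg.policy t (past D t))

/-! ### Lin-UCB -/

/-- `Λ̂ = lam I + ∑ φ φᵀ`. -/
def gram (φ : X × A → EuclideanSpace ℝ (Fin d)) (lam : ℝ) {n : ℕ} (D : Dataset X A n) :
    Matrix (Fin d) (Fin d) ℝ :=
  lam • (1 : Matrix (Fin d) (Fin d) ℝ) +
    ∑ i, Matrix.vecMulVec (φ ((D i).1, (D i).2.1)).ofLp (φ ((D i).1, (D i).2.1)).ofLp

/-- Ridge estimator `θ̂ = Λ̂⁻¹ ∑ r φ`. -/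
def ridge (φ : X × A → EuclideanSpace ℝ (Fin d)) (lam : ℝ) {n : ℕ} (D : Dataset X A n) :
    EuclideanSpace ℝ (Fin d) :=
  WithLp.toLp 2 ((gram φ lam D)⁻¹.mulVec
    (∑ i, (D i).2.2 • (φ ((D i).1, (D i).2.1)).ofLp))

/-- `‖v‖_V = √(vᵀ V v)`. -/
def matNorm (V : Matrix (Fin d) (Fin d) ℝ) (v : EuclideanSpace ℝ (Fin d)) : ℝ :=
  √(dotProduct v.ofLp (V.mulVec v.ofLp))

/-- Lin-UCB: `V̂^π = E_{x ∼ q, a ∼ π} ⟨φ(x,a), θ̂⟩` and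
`Û^π = E_{x ∼ q, a ∼ π} [β ‖φ(x,a)‖_{Λ̂⁻¹}]`. -/
def linUCB (φ : X × A → EuclideanSpace ℝ (Fin d)) (q : Measure X) (lam β : ℝ) : Oracle X A where
  estimate D π := ∫ p, inner ℝ (φ p) (ridge φ lam D) ∂(q ⊗ₘ π.1)
  uncertainty D π := ∫ p, β * matNorm (gram φ lam D)⁻¹ (φ p) ∂(q ⊗ₘ π.1)

/-- Confidence width `β = √d (1 + 2 √(log((1 + N)/δ)))` for `N` episodes in total. -/
def confWidth (d N : ℕ) (δ : ℝ) : ℝ :=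
  √(d : ℝ) * (1 + 2 * √(Real.log ((1 + N) / δ)))

end

end HybridBandit

/-! All three bounds are deterministic on an event that is an intersection of three, each failing
with probability at most `δ`. Confidence: after every round the ridge error in each direction `v` is
at most `β ‖v‖` in the `Λ̂⁻¹` norm. The self-normalized exponential is a supermartingale
(`lintegral_selfNormExp_snoc_le`), so Markov's inequality and a union bound over the rounds apply.
Widths: the expected widths of the policies played sum to at most twice the realized ones plus a
logarithm, by a second exponential supermartingale (`runLaw_sum_meanWidth_gt_le`). The realized
widths are summed through the growth of `log det Λ̂` (`sum_matNorm_le`). Offline: the assumed bound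
of `Û(D₀)` by `K d U`.

On this event optimism gives a gap of at most `2 Û` to each policy played, and pessimism gives
`gap(out) ≤ gap(π) + 2 Û(π)` for every comparator `π`. Since `Û` only decreases as data arrive, the
average regret and the output gap each have two bounds. The online one averages over rounds and is
of order `d / √N₁` up to logarithms. The offline one is `Û(π) ≤ K d U(π) ≤ K d √C U(ρ)`, with `U(ρ)
≤ 4 κ / √N₀` because the near-minimax estimator competes with the sample mean. The smaller of `1 /
√N₁` and `√(C / N₀)` is the hybrid rate up to a constant (`le_hybrid_rate`).

For the output and `C(π^{-ε}|ρ)` the comparator is the fair mixture of the optimal policy and the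
output. Its gap is half that of the output, so it exceeds `ε` once the output gap exceeds `2 ε`, and
`gap ≤ gap / 2 + 2 Û` can be solved for the gap. The output itself as comparator would give nothing.
-/

namespace HybridBandit

open Matrix

universe u v

/-! ### Inverse quadratic forms and rank-one updates. -/

section LinearAlgebra

variable {ι : Type*} [Fintype ι] [DecidableEq ι]

/-- The bilinear form `uᵀ V⁻¹ v`. -/
noncomputable def invForm (V : Matrix ι ι ℝ) (u v : ι → ℝ) : ℝ := u ⬝ᵥ (V⁻¹ *ᵥ v)

lemma invForm_add_left (V : Matrix ι ι ℝ) (u u' v : ι → ℝ) :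
    invForm V (u + u') v = invForm V u v + invForm V u' v := by
  simp [invForm, add_dotProduct]

lemma invForm_add_right (V : Matrix ι ι ℝ) (u v v' : ι → ℝ) :
    invForm V u (v + v') = invForm V u v + invForm V u v' := by
  simp [invForm, mulVec_add]

lemma invForm_smul_left (V : Matrix ι ι ℝ) (c : ℝ) (u v : ι → ℝ) :
    invForm V (c • u) v = c * invForm V u v := by
  simp [invForm]

lemma invForm_smul_right (V : Matrix ι ι ℝ) (c : ℝ) (u v : ι → ℝ) :
    invForm V u (c • v) = c * invForm V u v := by
  simp [invForm, mulVec_smul]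

variable {V : Matrix ι ι ℝ}

lemma invForm_comm (hV : V.PosDef) (u v : ι → ℝ) : invForm V u v = invForm V v u := by
  have h : (V⁻¹)ᵀ = V⁻¹ := by
    have := hV.inv.isHermitian
    rwa [IsHermitian, conjTranspose_eq_transpose_of_trivial] at this
  unfold invForm
  rw [dotProduct_mulVec, ← mulVec_transpose, h, dotProduct_comm]

lemma invForm_self_nonneg (hV : V.PosDef) (u : ι → ℝ) : 0 ≤ invForm V u u := by
  simpa [invForm] using hV.inv.posSemidef.dotProduct_mulVec_nonneg u

/-- Cauchy–Schwarz: the form at `u + t • v` is a nonnegative quadratic in `t`, so its discriminant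
is nonpositive. -/
lemma invForm_sq_le (hV : V.PosDef) (u v : ι → ℝ) :
    invForm V u v ^ 2 ≤ invForm V u u * invForm V v v := by
  have h : ∀ t : ℝ, 0 ≤ invForm V v v * (t * t) + (2 * invForm V u v) * t + invForm V u u := by
    intro t
    have := invForm_self_nonneg hV (u + t • v)
    rw [invForm_add_left, invForm_add_right, invForm_add_right, invForm_smul_left,
      invForm_smul_left, invForm_smul_right, invForm_smul_right, invForm_comm hV v u] at this
    linarith
  have := discrim_le_zero h
  unfold discrim at this
  linarith

lemma abs_invForm_le (hV : V.PosDef) (u v : ι → ℝ) :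
    |invForm V u v| ≤ √(invForm V u u) * √(invForm V v v) := by
  rw [← Real.sqrt_mul (invForm_self_nonneg hV u)]
  exact Real.abs_le_sqrt (invForm_sq_le hV u v)

omit [DecidableEq ι] in
lemma posDef_add_vecMulVec (hV : V.PosDef) (u : ι → ℝ) : (V + vecMulVec u u).PosDef := by
  refine hV.add_posSemidef ?_
  simpa using posSemidef_vecMulVec_self_star u

/-- Sherman–Morrison. -/
lemma invForm_add_vecMulVec (hV : V.PosDef) (u a b : ι → ℝ) :
    invForm (V + vecMulVec u u) a b =
      invForm V a b - invForm V a u * invForm V u b / (1 + invForm V u u) := by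
  have hw := invForm_self_nonneg hV u
  have hdet := (posDef_add_vecMulVec hV u).det_pos.ne'
  have hV' := hV.det_pos.ne'
  -- The claimed solution of `(V + u uᵀ) y = b`; checking this equation avoids computing the inverse
  -- matrix.
  set y := V⁻¹ *ᵥ b - (invForm V u b / (1 + invForm V u u)) • (V⁻¹ *ᵥ u) with hy
  have key : (V + vecMulVec u u) *ᵥ y = b := by
    have h1 : ∀ z, V *ᵥ (V⁻¹ *ᵥ z) = z := fun z => by
      rw [mulVec_mulVec, mul_nonsing_inv _ (isUnit_iff_ne_zero.2 hV'), one_mulVec]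
    have h2 : vecMulVec u u *ᵥ y = (u ⬝ᵥ y) • u := by
      ext i; simp [vecMulVec_mulVec, mul_comm]
    have h3 : u ⬝ᵥ y = invForm V u b - invForm V u b / (1 + invForm V u u) * invForm V u u := by
      simp [hy, dotProduct_sub, invForm]
    rw [add_mulVec, h2, h3, hy, mulVec_sub, mulVec_smul, h1, h1]
    have : invForm V u b - invForm V u b / (1 + invForm V u u) * invForm V u u =
        invForm V u b / (1 + invForm V u u) := by
      field_simp; ring
    rw [this]; simp
  have h4 : (V + vecMulVec u u)⁻¹ *ᵥ b = y := by
    conv_lhs => rw [← key]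
    rw [mulVec_mulVec, nonsing_inv_mul _ (isUnit_iff_ne_zero.2 hdet), one_mulVec]
  rw [invForm, h4, hy, dotProduct_sub, dotProduct_smul, smul_eq_mul]
  simp only [invForm]
  ring

lemma invForm_add_vecMulVec_le (hV : V.PosDef) (u a : ι → ℝ) :
    invForm (V + vecMulVec u u) a a ≤ invForm V a a := by
  rw [invForm_add_vecMulVec hV, invForm_comm hV u a]
  have := invForm_self_nonneg hV u
  have : 0 ≤ invForm V a u * invForm V a u / (1 + invForm V u u) := by
    have := mul_self_nonneg (invForm V a u)
    positivity
  linarith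

/-- Matrix determinant lemma. It normalizes the exponential supermartingale and drives the
elliptical potential. -/
lemma det_add_vecMulVec (hV : V.PosDef) (u : ι → ℝ) :
    (V + vecMulVec u u).det = V.det * (1 + invForm V u u) := by
  rw [vecMulVec_eq Unit, det_add_replicateCol_mul_replicateRow
    (isUnit_iff_ne_zero.2 hV.det_pos.ne')]
  congr 1
  simp [det_unique, Matrix.mul_apply, invForm, dotProduct, mulVec, Finset.sum_mul, Finset.mul_sum]
  rw [Finset.sum_comm]
  simp [mul_assoc]

/-- How the self-normalized norm `sᵀ V⁻¹ s` changes under a rank-one update. -/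
lemma invForm_update (hV : V.PosDef) (u s : ι → ℝ) (z : ℝ) :
    invForm (V + vecMulVec u u) (s + z • u) (s + z • u) = invForm V s s +
      (2 * z * invForm V u s + z ^ 2 * invForm V u u - invForm V u s ^ 2) /
        (1 + invForm V u u) := by
  have hw := invForm_self_nonneg hV u
  rw [invForm_add_vecMulVec hV]
  simp only [invForm_add_left, invForm_add_right, invForm_smul_left, invForm_smul_right,
    invForm_comm hV s u]
  field_simp
  ring

/-- Each eigenvalue is the quadratic form at its unit eigenvector, hence at most `c`, and the
determinant is their product. -/
lemma det_le_pow_of_quadForm_le (hV : V.PosDef) {c : ℝ}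
    (h : ∀ x : ι → ℝ, x ⬝ᵥ (V *ᵥ x) ≤ c * (x ⬝ᵥ x)) : V.det ≤ c ^ Fintype.card ι := by
  rw [hV.isHermitian.det_eq_prod_eigenvalues]
  simp only [RCLike.ofReal_real_eq_id, id]
  rw [← Finset.card_univ, ← Finset.prod_const]
  refine Finset.prod_le_prod (fun i _ => (hV.eigenvalues_pos i).le) fun i _ => ?_
  have h1 := h (hV.isHermitian.eigenvectorBasis i).ofLp
  rw [hV.isHermitian.mulVec_eigenvectorBasis] at h1
  have h2 : (hV.isHermitian.eigenvectorBasis i).ofLp ⬝ᵥ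
      (hV.isHermitian.eigenvectorBasis i).ofLp = 1 := by
    have := hV.isHermitian.eigenvectorBasis.orthonormal.1 i
    rw [EuclideanSpace.norm_eq, Real.sqrt_eq_one] at this
    simpa [dotProduct, sq] using this
  simpa [h2] using h1

end LinearAlgebra

/-! ### The regularized Gram matrix and the error of ridge regression. -/

section Gram

variable {X : Type u} {A : Type v} {d : ℕ}

/-- The initial segment of length `m` of a dataset. -/
def initSeg {α : Type*} {m n : ℕ} (h : m ≤ n) (D : Fin n → α) : Fin m → α :=
  fun i => D (Fin.castLE h i)

/-- The noise sum `∑ (r - ⟨φ, θ⟩) φ`. -/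
noncomputable def noiseSum (φ : X × A → EuclideanSpace ℝ (Fin d)) (θ : EuclideanSpace ℝ (Fin d))
    {n : ℕ} (D : Dataset X A n) : Fin d → ℝ :=
  ∑ i, ((D i).2.2 - inner ℝ (φ ((D i).1, (D i).2.1)) θ) • (φ ((D i).1, (D i).2.1)).ofLp

lemma real_inner_eq_dotProduct (x y : EuclideanSpace ℝ (Fin d)) :
    inner ℝ x y = x.ofLp ⬝ᵥ y.ofLp := by
  rw [EuclideanSpace.inner_eq_star_dotProduct, dotProduct_comm]; simp

lemma dotProduct_self_eq_norm_sq (x : EuclideanSpace ℝ (Fin d)) :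
    x.ofLp ⬝ᵥ x.ofLp = ‖x‖ ^ 2 := by
  rw [← real_inner_eq_dotProduct, real_inner_self_eq_norm_sq]

lemma matNorm_inv_eq (V : Matrix (Fin d) (Fin d) ℝ) (v : EuclideanSpace ℝ (Fin d)) :
    matNorm V⁻¹ v = √(invForm V v.ofLp v.ofLp) := rfl

variable (φ : X × A → EuclideanSpace ℝ (Fin d)) {lam : ℝ} {n : ℕ}

lemma gram_snoc (lam : ℝ) (D : Dataset X A n) (o : Obs X A) :
    gram φ lam (Fin.snoc (α := fun _ => Obs X A) D o : Dataset X A (n + 1)) =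
      gram φ lam D + vecMulVec (φ (o.1, o.2.1)).ofLp (φ (o.1, o.2.1)).ofLp := by
  simp [gram, Fin.sum_univ_castSucc, add_assoc]

lemma gram_eq_gram_init (lam : ℝ) (D : Dataset X A (n + 1)) :
    gram φ lam D = gram φ lam (Fin.init D : Dataset X A n) +
      vecMulVec (φ ((D (Fin.last n)).1, (D (Fin.last n)).2.1)).ofLp
        (φ ((D (Fin.last n)).1, (D (Fin.last n)).2.1)).ofLp := by
  conv_lhs => rw [← Fin.snoc_init_self D]
  exact gram_snoc φ lam _ _

lemma noiseSum_snoc (θ : EuclideanSpace ℝ (Fin d)) (D : Dataset X A n) (o : Obs X A) :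
    noiseSum φ θ (Fin.snoc (α := fun _ => Obs X A) D o : Dataset X A (n + 1)) =
      noiseSum φ θ D + (o.2.2 - inner ℝ (φ (o.1, o.2.1)) θ) • (φ (o.1, o.2.1)).ofLp := by
  simp [noiseSum, Fin.sum_univ_castSucc]

lemma gram_zero (lam : ℝ) (D : Dataset X A 0) : gram φ lam D = lam • 1 := by simp [gram]

lemma gram_posDef (hlam : 0 < lam) (D : Dataset X A n) : (gram φ lam D).PosDef := by
  induction n with
  | zero => rw [gram_zero]; exact Matrix.PosDef.one.smul hlam
  | succ n ih => rw [gram_eq_gram_init]; exact posDef_add_vecMulVec (ih _) _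

lemma invForm_gram_init_le (hlam : 0 < lam) (D : Dataset X A (n + 1)) (v : Fin d → ℝ) :
    invForm (gram φ lam D) v v ≤ invForm (gram φ lam (Fin.init D : Dataset X A n)) v v := by
  rw [gram_eq_gram_init]
  exact invForm_add_vecMulVec_le (gram_posDef φ hlam _) _ _

/-- Every new episode is a positive rank-one update, so uncertainty only shrinks; this lets offline
bounds serve at all later times. -/
lemma invForm_gram_initSeg_le (hlam : 0 < lam) {m : ℕ} (h : m ≤ n) (D : Dataset X A n)
    (v : Fin d → ℝ) :
    invForm (gram φ lam D) v v ≤ invForm (gram φ lam (initSeg h D)) v v := by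
  induction n with
  | zero => obtain rfl : m = 0 := by omega
            exact le_rfl
  | succ n ih =>
    rcases h.lt_or_eq with h' | rfl
    · exact (invForm_gram_init_le φ hlam D v).trans (ih (Nat.le_of_lt_succ h') (Fin.init D))
    · exact le_rfl

lemma invForm_gram_le (hlam : 0 < lam) (D : Dataset X A n) (v : EuclideanSpace ℝ (Fin d)) :
    invForm (gram φ lam D) v.ofLp v.ofLp ≤ ‖v‖ ^ 2 / lam := by
  refine (invForm_gram_initSeg_le φ hlam (Nat.zero_le n) D _).trans ?_
  have h1 : (lam • (1 : Matrix (Fin d) (Fin d) ℝ))⁻¹ = lam⁻¹ • 1 := by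
    apply inv_eq_left_inv
    simp [smul_smul, mul_inv_cancel₀ hlam.ne']
  rw [gram_zero, invForm, h1, smul_mulVec, one_mulVec, dotProduct_smul,
    dotProduct_self_eq_norm_sq, smul_eq_mul, div_eq_inv_mul]

lemma det_gram_le (hφ : ∀ z, ‖φ z‖ ≤ 1) (hlam : 0 < lam) (D : Dataset X A n) :
    (gram φ lam D).det ≤ (lam + n) ^ d := by
  have := det_le_pow_of_quadForm_le (gram_posDef φ hlam D) (c := lam + n) (fun x => ?_)
  · simpa using this
  have h0 : 0 ≤ x ⬝ᵥ x := by
    simpa using dotProduct_self_star_nonneg x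
  have h1 : ∀ i, x ⬝ᵥ (vecMulVec (φ ((D i).1, (D i).2.1)).ofLp
      (φ ((D i).1, (D i).2.1)).ofLp *ᵥ x) ≤ x ⬝ᵥ x := by
    intro i
    have h2 := abs_real_inner_le_norm (φ ((D i).1, (D i).2.1)) (WithLp.toLp 2 x)
    have h3 := hφ ((D i).1, (D i).2.1)
    have h4 := dotProduct_self_eq_norm_sq (WithLp.toLp 2 x)
    have h5 : |inner ℝ (φ ((D i).1, (D i).2.1)) (WithLp.toLp 2 x)| ≤ ‖WithLp.toLp 2 x‖ :=
      h2.trans (mul_le_of_le_one_left (norm_nonneg _) h3)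
    have h6 := sq_le_sq' (abs_le.1 h5).1 (abs_le.1 h5).2
    rw [real_inner_eq_dotProduct, ← h4] at h6
    have h7 : x ⬝ᵥ (vecMulVec (φ ((D i).1, (D i).2.1)).ofLp (φ ((D i).1, (D i).2.1)).ofLp *ᵥ x) =
        ((φ ((D i).1, (D i).2.1)).ofLp ⬝ᵥ x) ^ 2 := by
      simp [vecMulVec_mulVec, dotProduct_comm x, sq]
    rw [h7]; exact h6
  rw [gram, add_mulVec, dotProduct_add, smul_mulVec, one_mulVec, dotProduct_smul, smul_eq_mul,
    add_mul, Matrix.sum_mulVec, dotProduct_sum]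
  gcongr
  refine (Finset.sum_le_sum fun i _ => h1 i).trans ?_
  simp

lemma gram_mulVec (D : Dataset X A n) (lam : ℝ) (θ : EuclideanSpace ℝ (Fin d)) :
    gram φ lam D *ᵥ θ.ofLp = lam • θ.ofLp +
      ∑ i, (inner ℝ (φ ((D i).1, (D i).2.1)) θ) • (φ ((D i).1, (D i).2.1)).ofLp := by
  rw [gram, add_mulVec, smul_mulVec, one_mulVec, Matrix.sum_mulVec]
  congr 1
  refine Finset.sum_congr rfl fun i _ => ?_
  ext j
  simp [vecMulVec_mulVec, real_inner_eq_dotProduct, mul_comm]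

/-- The estimation error of ridge regression. -/
lemma inner_ridge_sub (hlam : 0 < lam) (D : Dataset X A n) (θ v : EuclideanSpace ℝ (Fin d)) :
    inner ℝ v (ridge φ lam D) - inner ℝ v θ =
      invForm (gram φ lam D) v.ofLp (noiseSum φ θ D + (-lam) • θ.ofLp) := by
  have hG := (gram_posDef φ hlam D).det_pos.ne'
  -- Each reward is noise plus `⟨φ, θ⟩`, and the signal part sums to `Λ̂ θ - lam θ`; the term `-lam
  -- θ` is the bias of the regularization.
  have h1 : ∑ i, (D i).2.2 • (φ ((D i).1, (D i).2.1)).ofLp =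
      noiseSum φ θ D + (-lam) • θ.ofLp + gram φ lam D *ᵥ θ.ofLp := by
    rw [gram_mulVec, noiseSum]
    simp only [sub_smul, Finset.sum_sub_distrib, neg_smul]
    abel
  have h2 : (ridge φ lam D).ofLp =
      (gram φ lam D)⁻¹ *ᵥ (noiseSum φ θ D + (-lam) • θ.ofLp) + θ.ofLp := by
    rw [ridge, h1, mulVec_add, mulVec_mulVec _ (gram φ lam D)⁻¹,
      nonsing_inv_mul _ (isUnit_iff_ne_zero.2 hG), one_mulVec]
  rw [real_inner_eq_dotProduct, real_inner_eq_dotProduct, h2, dotProduct_add]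
  simp [invForm]

/-- Cauchy–Schwarz on the noise and on the bias. The bias costs `lam · ‖θ‖ / √lam ≤ √lam`, since
`Λ̂` dominates `lam I`. -/
lemma abs_inner_ridge_sub_le (hlam : 0 < lam) (D : Dataset X A n)
    {θ : EuclideanSpace ℝ (Fin d)} (hθ : ‖θ‖ ≤ 1) (v : EuclideanSpace ℝ (Fin d)) :
    |inner ℝ v (ridge φ lam D) - inner ℝ v θ| ≤
      (√lam + √(invForm (gram φ lam D) (noiseSum φ θ D) (noiseSum φ θ D))) *
        matNorm (gram φ lam D)⁻¹ v := by
  have hG := gram_posDef φ hlam D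
  rw [inner_ridge_sub φ hlam, invForm_add_right, invForm_smul_right, matNorm_inv_eq]
  refine (abs_add_le _ _).trans ?_
  have h1 := abs_invForm_le hG v.ofLp (noiseSum φ θ D)
  have h2 := abs_invForm_le hG v.ofLp θ.ofLp
  have h3 : √(invForm (gram φ lam D) θ.ofLp θ.ofLp) ≤ 1 / √lam := by
    rw [one_div, ← Real.sqrt_inv, ← one_div]
    refine Real.sqrt_le_sqrt ((invForm_gram_le φ hlam D θ).trans ?_)
    gcongr
    exact pow_le_one₀ (norm_nonneg _) hθ
  rw [abs_mul, abs_neg, abs_of_pos hlam]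
  have h4 : lam * |invForm (gram φ lam D) v.ofLp θ.ofLp| ≤
      √lam * √(invForm (gram φ lam D) v.ofLp v.ofLp) := by
    calc _ ≤ lam * (√(invForm (gram φ lam D) v.ofLp v.ofLp) * (1 / √lam)) := by
          gcongr
          exact h2.trans (by gcongr)
      _ = (lam / √lam) * √(invForm (gram φ lam D) v.ofLp v.ofLp) := by ring
      _ = _ := by rw [Real.div_sqrt]
  nlinarith

lemma matNorm_gram_initSeg_le (hlam : 0 < lam) {m : ℕ} (h : m ≤ n) (D : Dataset X A n)
    (v : EuclideanSpace ℝ (Fin d)) :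
    matNorm (gram φ lam D)⁻¹ v ≤ matNorm (gram φ lam (initSeg h D))⁻¹ v :=
  Real.sqrt_le_sqrt (invForm_gram_initSeg_le φ hlam h D _)

lemma matNorm_gram_le_one (hlam : 1 ≤ lam) (D : Dataset X A n)
    {v : EuclideanSpace ℝ (Fin d)} (hv : ‖v‖ ≤ 1) : matNorm (gram φ lam D)⁻¹ v ≤ 1 := by
  rw [matNorm_inv_eq, Real.sqrt_le_one]
  refine (invForm_gram_le φ (by positivity) D v).trans ?_
  rw [div_le_one (by positivity)]
  exact (pow_le_one₀ (norm_nonneg _) hv).trans hlam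

end Gram

/-! ### Measurability of the matrix quantities. -/

section MeasurableMatrix

variable {Z : Type*} [MeasurableSpace Z] {ι : Type*} [Fintype ι] [DecidableEq ι]

lemma measurable_det {f : Z → Matrix ι ι ℝ} (hf : ∀ i j, Measurable fun z => f z i j) :
    Measurable fun z => (f z).det := by
  simp only [det_apply]
  fun_prop

/-- The inverse is the adjugate divided by the determinant, both polynomial in the entries. -/
lemma measurable_invForm {f : Z → Matrix ι ι ℝ} (hf : ∀ i j, Measurable fun z => f z i j)
    {u v : Z → ι → ℝ} (hu : Measurable u) (hv : Measurable v) :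
    Measurable fun z => invForm (f z) (u z) (v z) := by
  have hadj : ∀ i j, Measurable fun z => (f z).adjugate i j := by
    intro i j
    simp only [adjugate_apply]
    refine measurable_det fun k l => ?_
    simp only [updateRow_apply]
    split_ifs
    · exact measurable_const
    · exact hf k l
  have hdet := measurable_det hf
  simp only [invForm, inv_def, Ring.inverse_eq_inv', dotProduct, mulVec, Matrix.smul_apply]
  exact Finset.measurable_sum _ fun i _ => ((measurable_pi_apply i).comp hu).mul
    (Finset.measurable_sum _ fun j _ => (hdet.inv.smul (hadj i j)).mul
      ((measurable_pi_apply j).comp hv))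

end MeasurableMatrix

section MeasurableGram

variable {X : Type u} {A : Type v} [MeasurableSpace X] [MeasurableSpace A] {d : ℕ}
  {φ : X × A → EuclideanSpace ℝ (Fin d)}

lemma measurable_ofLp_comp {Z : Type*} [MeasurableSpace Z] {f : Z → EuclideanSpace ℝ (Fin d)}
    (hf : Measurable f) : Measurable fun z => (f z).ofLp := by
  fun_prop

lemma measurable_feature (hφ : Measurable φ) {n : ℕ} (i : Fin n) :
    Measurable fun D : Dataset X A n => φ ((D i).1, (D i).2.1) := by
  fun_prop

lemma measurable_gram_apply (hφ : Measurable φ) (lam : ℝ) {n : ℕ} (i j : Fin d) :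
    Measurable fun D : Dataset X A n => gram φ lam D i j := by
  have h := fun k => measurable_ofLp_comp (measurable_feature (n := n) hφ k)
  simp only [gram, Matrix.add_apply, Matrix.sum_apply, vecMulVec_apply]
  exact measurable_const.add (Finset.measurable_sum _ fun k _ =>
    ((measurable_pi_apply i).comp (h k)).mul ((measurable_pi_apply j).comp (h k)))

lemma measurable_noiseSum (hφ : Measurable φ) (θ : EuclideanSpace ℝ (Fin d)) {n : ℕ} :
    Measurable fun D : Dataset X A n => noiseSum φ θ D := by
  have h := fun k => measurable_ofLp_comp (measurable_feature (n := n) hφ k)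
  have h' := fun k => measurable_feature (n := n) hφ k
  unfold noiseSum
  fun_prop

lemma measurable_matNorm_gram (hφ : Measurable φ) (lam : ℝ) {n : ℕ} :
    Measurable fun p : Dataset X A n × (X × A) => matNorm (gram φ lam p.1)⁻¹ (φ p.2) := by
  simp only [matNorm_inv_eq]
  refine (measurable_invForm (fun i j => (measurable_gram_apply hφ lam i j).comp measurable_fst)
    ?_ ?_).sqrt <;> exact measurable_ofLp_comp (hφ.comp measurable_snd)

end MeasurableGram

/-! ### Exponential moment inequalities for one episode. -/

section Subgaussian

/-- Exponential moment of a quadratic in a `1`-sub-Gaussian variable. -/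
lemma lintegral_exp_quadratic_le {ν : Measure ℝ} [IsProbabilityMeasure ν]
    (hν : HasSubgaussianMGF id 1 ν) {w : ℝ} (hw : 0 ≤ w) (s : ℝ) :
    ∫⁻ z, ENNReal.ofReal (Real.exp ((2 * z * s + z ^ 2 * w - s ^ 2) / (1 + w) / 2)) ∂ν ≤
      ENNReal.ofReal √(1 + w) := by
  have hmgf : ∀ t, ∫⁻ z, ENNReal.ofReal (Real.exp (t * z)) ∂ν ≤
      ENNReal.ofReal (Real.exp (t ^ 2 / 2)) := by
    intro t
    have hi : Integrable (fun z : ℝ => Real.exp (t * z)) ν := hν.integrable_exp_mul t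
    rw [← ofReal_integral_eq_lintegral_ofReal hi
      (Filter.Eventually.of_forall fun _ => (Real.exp_pos _).le)]
    exact ENNReal.ofReal_le_ofReal (by simpa [mgf] using hν.mgf_le t)
  -- For `w = 0` the Gaussians used below degenerate, and the claim is the moment bound at `s`.
  rcases hw.eq_or_lt with rfl | hw
  · have : ∀ z : ℝ, ENNReal.ofReal (Real.exp ((2 * z * s + z ^ 2 * 0 - s ^ 2) / (1 + 0) / 2)) =
        ENNReal.ofReal (Real.exp (s * z)) * ENNReal.ofReal (Real.exp (-(s ^ 2 / 2))) := by
      intro z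
      rw [← ENNReal.ofReal_mul (Real.exp_pos _).le, ← Real.exp_add]
      congr 2; ring
    simp only [this]
    rw [lintegral_mul_const' _ _ ENNReal.ofReal_ne_top]
    refine (mul_le_mul_left (hmgf s) _).trans ?_
    rw [← ENNReal.ofReal_mul (Real.exp_pos _).le, ← Real.exp_add]
    simp
  -- Gaussian linearization: the exponential of the quadratic in `z` is, up to a constant, the
  -- average of `exp (g z)` over `g` of mean `s / (1 + w)` and variance `w / (1 + w)`. Averaging
  -- over `z` first then needs only the sub-Gaussian bound.
  set m := s / (1 + w) with hm
  obtain ⟨vv, hvv⟩ : ∃ v : NNReal, (v : ℝ) = w / (1 + w) := ⟨⟨_, by positivity⟩, rfl⟩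
  have hvv0 : vv ≠ 0 := by
    rintro rfl
    exact (by positivity : w / (1 + w) ≠ 0) hvv.symm
  obtain ⟨ww, hww⟩ : ∃ v : NNReal, (v : ℝ) = w := ⟨⟨w, hw.le⟩, rfl⟩
  have hww0 : ww ≠ 0 := by
    rintro rfl
    exact hw.ne hww
  have hlin : ∀ z : ℝ, ENNReal.ofReal (Real.exp ((2 * z * s + z ^ 2 * w - s ^ 2) / (1 + w) / 2)) =
      ENNReal.ofReal (Real.exp (-(s ^ 2 / (1 + w) / 2))) *
        ∫⁻ g, ENNReal.ofReal (Real.exp (g * z)) ∂(gaussianReal m vv) := by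
    intro z
    have h1 := mgf_gaussianReal (p := gaussianReal m vv) (X := id) (μ := m) (v := vv)
      (by simp) z
    have h2 : ∫⁻ g, ENNReal.ofReal (Real.exp (g * z)) ∂(gaussianReal m vv) =
        ENNReal.ofReal (Real.exp (m * z + vv * z ^ 2 / 2)) := by
      rw [← h1, mgf, ← ofReal_integral_eq_lintegral_ofReal _
        (Filter.Eventually.of_forall fun _ => (Real.exp_pos _).le)]
      · simp [mul_comm]
      · simpa [mul_comm] using integrable_exp_mul_gaussianReal (μ := m) (v := vv) z
    rw [h2, ← ENNReal.ofReal_mul (Real.exp_pos _).le, ← Real.exp_add]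
    congr 2
    simp only [hvv, hm]
    field_simp
    ring
  simp only [hlin]
  have hmeas : Measurable fun p : ℝ × ℝ => ENNReal.ofReal (Real.exp (p.2 * p.1)) := by fun_prop
  rw [lintegral_const_mul' _ _ ENNReal.ofReal_ne_top, lintegral_lintegral_swap hmeas.aemeasurable]
  have hg : ∫⁻ g, ∫⁻ z, ENNReal.ofReal (Real.exp (g * z)) ∂ν ∂(gaussianReal m vv) ≤
      ENNReal.ofReal (√(1 + w) * Real.exp (s ^ 2 / (1 + w) / 2)) := by
    refine (lintegral_mono fun g => hmgf g).trans ?_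
    rw [gaussianReal_of_var_ne_zero _ hvv0,
      lintegral_withDensity_eq_lintegral_mul _ (measurable_gaussianPDF m vv) (by fun_prop)]
    -- Completing the square: the weight `exp (g² / 2)` turns this density into that of mean `s` and
    -- variance `w`, and the ratio of normalizations is `√(1 + w)`.
    have hpt : ∀ g, (gaussianPDF m vv * fun g => ENNReal.ofReal (Real.exp (g ^ 2 / 2))) g =
        ENNReal.ofReal (√(1 + w) * Real.exp (s ^ 2 / (1 + w) / 2)) * gaussianPDF s ww g := by
      intro g
      simp only [Pi.mul_apply, gaussianPDF]
      rw [← ENNReal.ofReal_mul (gaussianPDFReal_nonneg _ _ _), ← ENNReal.ofReal_mul (by positivity)]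
      congr 1
      simp only [gaussianPDFReal, hvv, hww, hm]
      have e1 : (√(2 * Real.pi * (w / (1 + w))))⁻¹ = √(1 + w) * (√(2 * Real.pi * w))⁻¹ := by
        rw [← mul_div_assoc, Real.sqrt_div (by positivity), inv_div, div_eq_mul_inv]
      have e2 : Real.exp (-(g - s / (1 + w)) ^ 2 / (2 * (w / (1 + w)))) * Real.exp (g ^ 2 / 2) =
          Real.exp (s ^ 2 / (1 + w) / 2) * Real.exp (-(g - s) ^ 2 / (2 * w)) := by
        rw [← Real.exp_add, ← Real.exp_add]
        congr 1
        field_simp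
        ring
      rw [e1]
      linear_combination (√(1 + w) * (√(2 * Real.pi * w))⁻¹) * e2
    simp only [hpt]
    rw [lintegral_const_mul' _ _ ENNReal.ofReal_ne_top, lintegral_gaussianPDF_eq_one s hww0,
      mul_one]
  refine (mul_le_mul_right hg _).trans ?_
  rw [← ENNReal.ofReal_mul (Real.exp_pos _).le]
  refine ENNReal.ofReal_le_ofReal ?_
  rw [mul_left_comm, ← Real.exp_add]
  simp

/-- A `1`-sub-Gaussian variable has a bounded second moment. -/
lemma integrable_sq_and_integral_sq_le {ν : Measure ℝ} [IsProbabilityMeasure ν]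
    (hν : HasSubgaussianMGF id 1 ν) :
    Integrable (fun z : ℝ => z ^ 2) ν ∧ ∫ z, z ^ 2 ∂ν ≤ 4 := by
  -- For `z ≥ 0`, add `e^z ≥ 1 + z + z² / 2` and `e^{-z} ≥ 1 - z`. In expectation the right side is
  -- at most `4 e^{1/2} - 4 ≤ 4`.
  have hpt : ∀ z : ℝ, z ^ 2 ≤ 2 * (Real.exp (1 * z) + Real.exp (-1 * z)) - 4 := by
    intro z
    wlog hz : 0 ≤ z generalizing z
    · have := this (-z) (by linarith)
      simp only [one_mul, neg_mul, neg_neg, even_two, Even.neg_pow] at this ⊢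
      linarith
    have h1 := Real.quadratic_le_exp_of_nonneg hz
    have h2 := Real.add_one_le_exp (-z)
    simp only [one_mul, neg_mul]
    linarith
  have h1 : Integrable (fun z : ℝ => Real.exp (1 * z)) ν := hν.integrable_exp_mul 1
  have h2 : Integrable (fun z : ℝ => Real.exp (-1 * z)) ν := hν.integrable_exp_mul (-1)
  have h12 : Integrable (fun z : ℝ => 2 * (Real.exp (1 * z) + Real.exp (-1 * z))) ν :=
    (h1.add h2).const_mul 2
  have hI := h12.sub (integrable_const (4 : ℝ))
  have hsq : Integrable (fun z : ℝ => z ^ 2) ν :=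
    hI.mono' (by fun_prop) (Filter.Eventually.of_forall fun z => by
      rw [Real.norm_of_nonneg (sq_nonneg z)]; exact hpt z)
  refine ⟨hsq, (integral_mono hsq hI hpt).trans ?_⟩
  simp only [Pi.sub_apply]
  rw [integral_sub h12 (integrable_const 4), integral_const_mul, integral_add h1 h2]
  have m1 := hν.mgf_le 1
  have m2 := hν.mgf_le (-1)
  simp only [mgf, id] at m1 m2
  have e : Real.exp (1 / 2) ≤ 2 := by
    rw [Real.exp_half, Real.sqrt_le_left (by norm_num)]
    linarith [Real.exp_one_lt_d9]
  norm_num at m1 m2 e ⊢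
  linarith

/-- `E e^{E[Y]/2 - Y} ≤ 1` for a random variable `Y` with values in `[0, 1]`. -/
lemma lintegral_exp_half_mean_sub_le {Ω : Type*} [MeasurableSpace Ω] {μ : Measure Ω}
    [IsProbabilityMeasure μ] {Y : Ω → ℝ} (hY : Measurable Y) (h0 : ∀ x, 0 ≤ Y x)
    (h1 : ∀ x, Y x ≤ 1) :
    ∫⁻ x, ENNReal.ofReal (Real.exp ((∫ y, Y y ∂μ) / 2 - Y x)) ∂μ ≤ 1 := by
  have hYi : Integrable Y μ := Integrable.of_bound hY.aestronglyMeasurable 1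
    (Filter.Eventually.of_forall fun x => by rw [Real.norm_of_nonneg (h0 x)]; exact h1 x)
  -- On `[0, 1]`, `(1 - y / 2)(1 + y + y² / 2) = 1 + y / 2 - y³ / 4 ≥ 1`. The factor `1 / 2` on the
  -- mean comes from here.
  have hpt : ∀ x, Real.exp (-Y x) ≤ 1 - Y x / 2 := by
    intro x
    have := Real.quadratic_le_exp_of_nonneg (h0 x)
    rw [Real.exp_neg]
    refine inv_le_of_inv_le₀ ?_ ?_
    · linarith [h1 x]
    · refine le_trans ?_ this
      rw [inv_le_iff_one_le_mul₀ (by linarith [h1 x])]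
      nlinarith [h0 x, h1 x, mul_nonneg (h0 x) (sub_nonneg.2 (h1 x)),
        mul_nonneg (mul_nonneg (h0 x) (h0 x)) (sub_nonneg.2 (h1 x))]
  set m := ∫ y, Y y ∂μ
  calc ∫⁻ x, ENNReal.ofReal (Real.exp (m / 2 - Y x)) ∂μ
      ≤ ∫⁻ x, ENNReal.ofReal (Real.exp (m / 2) * (1 - Y x / 2)) ∂μ := by
        refine lintegral_mono fun x => ENNReal.ofReal_le_ofReal ?_
        rw [sub_eq_add_neg, Real.exp_add]
        exact mul_le_mul_of_nonneg_left (hpt x) (Real.exp_pos _).le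
    _ = ENNReal.ofReal (∫ x, Real.exp (m / 2) * (1 - Y x / 2) ∂μ) := by
        rw [ofReal_integral_eq_lintegral_ofReal]
        · exact ((integrable_const _).sub (hYi.div_const 2)).const_mul _
        · exact Filter.Eventually.of_forall fun x =>
            mul_nonneg (Real.exp_pos _).le (by linarith [h1 x])
    _ ≤ 1 := by
        rw [integral_const_mul, integral_sub (integrable_const _) (hYi.div_const 2),
          integral_div, ENNReal.ofReal_le_one]
        simp only [integral_const, probReal_univ, smul_eq_mul, mul_one]
        have := Real.add_one_le_exp (-(m / 2))
        calc Real.exp (m / 2) * (1 - m / 2) ≤ Real.exp (m / 2) * Real.exp (-(m / 2)) := by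
              gcongr; linarith
          _ = 1 := by rw [← Real.exp_add]; simp

end Subgaussian

/-! ### The law of a run and supermartingales along it. -/

section Run

variable {X : Type u} {A : Type v} [MeasurableSpace X] [MeasurableSpace A] {d : ℕ}
  {φ : X × A → EuclideanSpace ℝ (Fin d)}

lemma measurable_snoc {n : ℕ} :
    Measurable fun p : Dataset X A n × Obs X A =>
      (Fin.snoc (α := fun _ => Obs X A) p.1 p.2 : Dataset X A (n + 1)) := by
  refine measurable_pi_iff.2 fun i => ?_
  refine Fin.lastCases ?_ (fun j => ?_) i
  · simpa using measurable_snd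
  · simpa [Function.comp_def] using (measurable_pi_apply j).comp measurable_fst

lemma measurable_initSeg {m n : ℕ} (h : m ≤ n) :
    Measurable (initSeg h : Dataset X A n → Dataset X A m) :=
  measurable_pi_iff.2 fun i => measurable_pi_apply (Fin.castLE h i)

lemma measurable_init {n : ℕ} :
    Measurable fun D : Dataset X A (n + 1) => (Fin.init D : Dataset X A n) :=
  measurable_pi_iff.2 fun i => measurable_pi_apply i.castSucc

lemma measurable_observe (hφ : Measurable φ) (θ : EuclideanSpace ℝ (Fin d)) :
    Measurable (observe φ θ) := by
  unfold observe
  fun_prop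

lemma isProbabilityMeasure_episodeLaw (hφ : Measurable φ) (M : Env X d) (π : Policy X A) :
    IsProbabilityMeasure (episodeLaw φ M π) :=
  Measure.isProbabilityMeasure_map (measurable_observe hφ _).aemeasurable

lemma isProbabilityMeasure_offlineLaw (hφ : Measurable φ) (M : Env X d) (ρ : Policy X A) (n : ℕ) :
    IsProbabilityMeasure (offlineLaw φ M ρ n) := by
  have := isProbabilityMeasure_episodeLaw hφ M ρ
  unfold offlineLaw
  infer_instance

variable {N₀ : ℕ}

lemma isMarkovKernel_nextEpisode (hφ : Measurable φ) (M : Env X d) (alg : OnlineAlg X A N₀)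
    (t : ℕ) : IsMarkovKernel (nextEpisode φ M alg t) :=
  Kernel.IsMarkovKernel.map _ (measurable_observe hφ _)

lemma const_compProd_apply_eq (M : Env X d) (alg : OnlineAlg X A N₀) (t : ℕ)
    (D : Dataset X A (N₀ + t)) :
    (Kernel.const (Dataset X A (N₀ + t)) M.q ⊗ₖ (alg t).1) D = M.q ⊗ₘ (alg.policy t D).1 := by
  ext s hs
  rw [Kernel.compProd_apply hs, Measure.compProd_apply hs]
  rfl

/-- Given the past, an online episode is an ordinary episode of the policy played, so one-step
estimates need only be proved for `episodeLaw`. -/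
lemma nextEpisode_apply (hφ : Measurable φ) (M : Env X d) (alg : OnlineAlg X A N₀) (t : ℕ)
    (D : Dataset X A (N₀ + t)) :
    nextEpisode φ M alg t D = episodeLaw φ M (alg.policy t D) := by
  rw [nextEpisode, Kernel.map_apply _ (measurable_observe hφ _), Kernel.prod_apply,
    const_compProd_apply_eq, Kernel.const_apply, episodeLaw]

lemma isProbabilityMeasure_runLaw (hφ : Measurable φ) (M : Env X d) (ρ : Policy X A)
    (alg : OnlineAlg X A N₀) (t : ℕ) : IsProbabilityMeasure (runLaw φ M ρ alg t) := by
  induction t with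
  | zero => exact isProbabilityMeasure_offlineLaw hφ M ρ N₀
  | succ t ih =>
    have := isMarkovKernel_nextEpisode hφ M alg t
    exact Measure.isProbabilityMeasure_map measurable_snoc.aemeasurable

lemma runLaw_map_init (hφ : Measurable φ) (M : Env X d) (ρ : Policy X A)
    (alg : OnlineAlg X A N₀) (t : ℕ) :
    (runLaw φ M ρ alg (t + 1)).map
      (fun D : Dataset X A (N₀ + t + 1) => (Fin.init D : Dataset X A (N₀ + t))) =
      runLaw φ M ρ alg t := by
  have := isMarkovKernel_nextEpisode hφ M alg t
  have := isProbabilityMeasure_runLaw hφ M ρ alg t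
  rw [runLaw, Measure.map_map measurable_init measurable_snoc]
  have : (fun D : Dataset X A (N₀ + t + 1) => (Fin.init D : Dataset X A (N₀ + t))) ∘
      (fun p : Dataset X A (N₀ + t) × Obs X A =>
        Fin.snoc (α := fun _ => Obs X A) p.1 p.2) = Prod.fst := by
    funext p
    exact Fin.init_snoc (α := fun _ => Obs X A) _ _
  rw [this]
  exact Measure.fst_compProd _ _

lemma runLaw_map_initSeg (hφ : Measurable φ) (M : Env X d) (ρ : Policy X A)
    (alg : OnlineAlg X A N₀) {s t : ℕ} (h : s ≤ t) :
    (runLaw φ M ρ alg t).map (initSeg (Nat.add_le_add_left h N₀)) = runLaw φ M ρ alg s := by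
  induction t with
  | zero =>
    obtain rfl : s = 0 := by omega
    exact Measure.map_id
  | succ t ih =>
    rcases h.lt_or_eq with h' | rfl
    · rw [← ih (Nat.le_of_lt_succ h'), ← runLaw_map_init hφ M ρ alg t,
        Measure.map_map (measurable_initSeg _) measurable_init]
      rfl
    · exact Measure.map_id

/-- An event for a shorter run is as likely when the run is continued. -/
lemma runLaw_preimage_initSeg_le (hφ : Measurable φ) (M : Env X d) (ρ : Policy X A)
    (alg : OnlineAlg X A N₀) {s t : ℕ} (h : s ≤ t) (E : Set (Dataset X A (N₀ + s))) :
    runLaw φ M ρ alg t (initSeg (Nat.add_le_add_left h N₀) ⁻¹' E) ≤ runLaw φ M ρ alg s E := by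
  rw [← runLaw_map_initSeg hφ M ρ alg h]
  exact Measure.le_map_apply (measurable_initSeg _).aemeasurable E

lemma lintegral_episodeLaw (hφ : Measurable φ) (M : Env X d) (π : Policy X A)
    {f : Obs X A → ℝ≥0∞} (hf : Measurable f) :
    ∫⁻ o, f o ∂(episodeLaw φ M π) =
      ∫⁻ p, ∫⁻ z, f (p.1, p.2, inner ℝ (φ p) M.θ + z) ∂M.noise ∂(M.q ⊗ₘ π.1) := by
  rw [episodeLaw, lintegral_map hf (measurable_observe hφ _)]
  exact lintegral_prod _ (hf.comp (measurable_observe hφ _)).aemeasurable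

/-- A nonnegative supermartingale along a run. -/
lemma lintegral_runLaw_le (hφ : Measurable φ) (M : Env X d) (ρ : Policy X A)
    (alg : OnlineAlg X A N₀) (f : (t : ℕ) → Dataset X A (N₀ + t) → ℝ≥0∞)
    (hf : ∀ t, Measurable (f t))
    (h : ∀ t D, ∫⁻ o, f (t + 1) (Fin.snoc (α := fun _ => Obs X A) D o)
      ∂(episodeLaw φ M (alg.policy t D)) ≤ f t D) (t : ℕ) :
    ∫⁻ D, f t D ∂(runLaw φ M ρ alg t) ≤ ∫⁻ D, f 0 D ∂(offlineLaw φ M ρ N₀) := by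
  induction t with
  | zero => exact le_rfl
  | succ t ih =>
    have := isMarkovKernel_nextEpisode hφ M alg t
    have := isProbabilityMeasure_runLaw hφ M ρ alg t
    have hm : Measurable fun p : Dataset X A (N₀ + t) × Obs X A =>
        f (t + 1) (Fin.snoc (α := fun _ => Obs X A) p.1 p.2) :=
      (hf (t + 1)).comp measurable_snoc
    refine le_trans ?_ ih
    refine (lintegral_map (hf (t + 1)) measurable_snoc).le.trans ?_
    refine (Measure.lintegral_compProd hm).le.trans ?_
    refine lintegral_mono fun D => ?_
    rw [nextEpisode_apply hφ]
    exact h t D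

/-- A nonnegative supermartingale along an offline dataset. -/
lemma lintegral_offlineLaw_le (hφ : Measurable φ) (M : Env X d) (ρ : Policy X A)
    (f : (n : ℕ) → Dataset X A n → ℝ≥0∞) (hf : ∀ n, Measurable (f n))
    (h : ∀ n D, ∫⁻ o, f (n + 1) (Fin.snoc (α := fun _ => Obs X A) D o)
      ∂(episodeLaw φ M ρ) ≤ f n D) (n : ℕ) :
    ∫⁻ D, f n D ∂(offlineLaw φ M ρ n) ≤ f 0 Fin.elim0 := by
  have := isProbabilityMeasure_episodeLaw hφ M ρ
  induction n with
  | zero =>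
    have := isProbabilityMeasure_offlineLaw hφ M ρ 0
    have h0 : ∀ D : Dataset X A 0, f 0 D = f 0 Fin.elim0 := fun D => by
      rw [Subsingleton.elim D Fin.elim0]
    simp [h0]
  | succ n ih =>
    refine le_trans ?_ ih
    have hmp := (measurePreserving_piFinSuccAbove
      (fun _ : Fin (n + 1) => episodeLaw φ M ρ) (Fin.last n)).symm
    have e := hmp.lintegral_comp (hf (n + 1))
    -- The product law splits off its last episode, which is integrated first.
    rw [offlineLaw, ← e, lintegral_prod_symm]
    · refine lintegral_mono fun D => ?_
      refine le_trans (le_of_eq ?_) (h n D)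
      refine lintegral_congr fun o => ?_
      congr 1
      exact Fin.insertNth_last' (β := Obs X A) o D
    · exact ((hf (n + 1)).comp hmp.measurable).aemeasurable

end Run

/-! ### Self-normalized concentration and the confidence width. -/

section Confidence

variable {X : Type u} {A : Type v} [MeasurableSpace X] [MeasurableSpace A] {d : ℕ}
  {φ : X × A → EuclideanSpace ℝ (Fin d)} {N₀ : ℕ}

/-- The self-normalized exponential process `det(Λ̂)^{-1/2} exp(½ ‖∑ ξ φ‖²_{Λ̂⁻¹})`. -/
noncomputable def selfNormExp (φ : X × A → EuclideanSpace ℝ (Fin d))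
    (θ : EuclideanSpace ℝ (Fin d)) (lam : ℝ) {n : ℕ} (D : Dataset X A n) : ℝ≥0∞ :=
  ENNReal.ofReal (Real.exp (invForm (gram φ lam D) (noiseSum φ θ D) (noiseSum φ θ D) / 2) /
    √(gram φ lam D).det)

lemma measurable_invForm_noiseSum (hφ : Measurable φ) (θ : EuclideanSpace ℝ (Fin d)) (lam : ℝ)
    {n : ℕ} : Measurable fun D : Dataset X A n =>
      invForm (gram φ lam D) (noiseSum φ θ D) (noiseSum φ θ D) :=
  measurable_invForm (measurable_gram_apply hφ lam) (measurable_noiseSum hφ θ)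
    (measurable_noiseSum hφ θ)

lemma measurable_selfNormExp (hφ : Measurable φ) (θ : EuclideanSpace ℝ (Fin d)) (lam : ℝ)
    {n : ℕ} : Measurable fun D : Dataset X A n => selfNormExp φ θ lam D :=
  (((measurable_invForm_noiseSum hφ θ lam).div_const 2).exp.div
    (measurable_det (measurable_gram_apply hφ lam)).sqrt).ennreal_ofReal

/-- For fixed context and arm the update multiplies the process by an exponential quadratic in the
noise divided by `√(1 + w)`; `lintegral_exp_quadratic_le` says that this factor has mean at most
one. -/
lemma lintegral_selfNormExp_snoc_le (hφ : Measurable φ) {lam : ℝ} (hlam : 0 < lam) (M : Env X d)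
    (π : Policy X A) {n : ℕ} (D : Dataset X A n) :
    ∫⁻ o, selfNormExp φ M.θ lam (Fin.snoc (α := fun _ => Obs X A) D o : Dataset X A (n + 1))
      ∂(episodeLaw φ M π) ≤ selfNormExp φ M.θ lam D := by
  have hm : Measurable fun o : Obs X A => selfNormExp φ M.θ lam
      (Fin.snoc (α := fun _ => Obs X A) D o : Dataset X A (n + 1)) :=
    (measurable_selfNormExp hφ M.θ lam).comp
      (measurable_snoc.comp (measurable_const.prodMk measurable_id))
  rw [lintegral_episodeLaw hφ M π hm]
  have hG := gram_posDef φ hlam D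
  have hdet := hG.det_pos
  have key : ∀ p : X × A, ∫⁻ z, selfNormExp φ M.θ lam (Fin.snoc (α := fun _ => Obs X A) D
      (p.1, p.2, inner ℝ (φ p) M.θ + z) : Dataset X A (n + 1)) ∂M.noise ≤
        selfNormExp φ M.θ lam D := by
    intro p
    set w := invForm (gram φ lam D) (φ p).ofLp (φ p).ofLp with hw
    set s := invForm (gram φ lam D) (φ p).ofLp (noiseSum φ M.θ D) with hs
    have hw0 : 0 ≤ w := invForm_self_nonneg hG _
    have e : ∀ z : ℝ, selfNormExp φ M.θ lam (Fin.snoc (α := fun _ => Obs X A) D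
        (p.1, p.2, inner ℝ (φ p) M.θ + z) : Dataset X A (n + 1)) =
        selfNormExp φ M.θ lam D * ENNReal.ofReal (√(1 + w))⁻¹ *
          ENNReal.ofReal (Real.exp ((2 * z * s + z ^ 2 * w - s ^ 2) / (1 + w) / 2)) := by
      intro z
      rw [selfNormExp, gram_snoc, noiseSum_snoc]
      simp only [Prod.mk.eta, add_sub_cancel_left]
      rw [invForm_update hG, det_add_vecMulVec hG, selfNormExp,
        ← ENNReal.ofReal_mul (by positivity), ← ENNReal.ofReal_mul (by positivity),
        ← hw, ← hs, add_div, Real.exp_add, Real.sqrt_mul hdet.le]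
      congr 1
      field_simp
    simp only [e]
    have hS : selfNormExp φ M.θ lam D * ENNReal.ofReal (√(1 + w))⁻¹ ≠ ⊤ :=
      ENNReal.mul_ne_top ENNReal.ofReal_ne_top ENNReal.ofReal_ne_top
    rw [lintegral_const_mul' _ _ hS]
    calc _ ≤ selfNormExp φ M.θ lam D * ENNReal.ofReal (√(1 + w))⁻¹ * ENNReal.ofReal √(1 + w) := by
          gcongr
          exact lintegral_exp_quadratic_le M.noise_subG hw0 s
      _ = _ := by
          rw [mul_assoc, ← ENNReal.ofReal_mul (by positivity), inv_mul_cancel₀ (by positivity)]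
          simp
  calc _ ≤ ∫⁻ _, selfNormExp φ M.θ lam D ∂(M.q ⊗ₘ π.1) := lintegral_mono key
    _ = _ := by simp

lemma lintegral_selfNormExp_le (hφ : Measurable φ) {lam : ℝ} (hlam : 0 < lam) (M : Env X d)
    (ρ : Policy X A) (alg : OnlineAlg X A N₀) (t : ℕ) :
    ∫⁻ D, selfNormExp φ M.θ lam D ∂(runLaw φ M ρ alg t) ≤ ENNReal.ofReal (√(lam ^ d))⁻¹ := by
  refine (lintegral_runLaw_le hφ M ρ alg (fun _ D => selfNormExp φ M.θ lam D)
    (fun _ => measurable_selfNormExp hφ _ _)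
    (fun _ _ => lintegral_selfNormExp_snoc_le hφ hlam M _ _) t).trans ?_
  refine (lintegral_offlineLaw_le hφ M ρ (fun _ D => selfNormExp φ M.θ lam D)
    (fun _ => measurable_selfNormExp hφ _ _)
    (fun _ _ => lintegral_selfNormExp_snoc_le hφ hlam M _ _) N₀).trans ?_
  simp [selfNormExp, gram_zero, noiseSum, invForm]

/-- Self-normalized tail bound. -/
lemma runLaw_invForm_noiseSum_gt_le (hφ : Measurable φ) (hφ1 : ∀ z, ‖φ z‖ ≤ 1) {lam : ℝ}
    (hlam : 0 < lam) (M : Env X d) (ρ : Policy X A) (alg : OnlineAlg X A N₀) (t : ℕ) {η : ℝ}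
    (hη : 0 < η) :
    runLaw φ M ρ alg t {D | d * Real.log ((lam + (N₀ + t : ℕ)) / lam) + 2 * Real.log (1 / η) <
      invForm (gram φ lam D) (noiseSum φ M.θ D) (noiseSum φ M.θ D)} ≤ ENNReal.ofReal η := by
  set c := ENNReal.ofReal (√(lam ^ d))⁻¹ with hc
  have hc0 : c ≠ 0 := by
    rw [hc, Ne, ENNReal.ofReal_eq_zero, not_le]; positivity
  have hMk := mul_meas_ge_le_lintegral (μ := runLaw φ M ρ alg t)
    (measurable_selfNormExp hφ M.θ lam) (c * (ENNReal.ofReal η)⁻¹)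
  have h2 := hMk.trans (lintegral_selfNormExp_le hφ hlam M ρ alg t)
  rw [← hc, mul_assoc] at h2
  have h3 : (ENNReal.ofReal η)⁻¹ * runLaw φ M ρ alg t
      {D | c * (ENNReal.ofReal η)⁻¹ ≤ selfNormExp φ M.θ lam D} ≤ 1 := by
    refine (ENNReal.mul_le_mul_iff_right hc0 ENNReal.ofReal_ne_top).1 ?_
    rwa [mul_one]
  rw [← ENNReal.div_eq_inv_mul, ENNReal.div_le_iff (by simpa using hη) ENNReal.ofReal_ne_top,
    one_mul] at h3
  refine (measure_mono fun D hD => ?_).trans h3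
  simp only [Set.mem_ofPred_eq] at hD ⊢
  have hG := gram_posDef φ hlam D
  have hdet := hG.det_pos
  rw [hc, ← ENNReal.ofReal_inv_of_pos hη, ← ENNReal.ofReal_mul (by positivity), selfNormExp]
  refine ENNReal.ofReal_le_ofReal ?_
  -- The random determinant is replaced by its deterministic bound, which makes the threshold
  -- nonrandom.
  have h4 : √(gram φ lam D).det ≤ √((lam + (N₀ + t : ℕ)) ^ d) :=
    Real.sqrt_le_sqrt (det_gram_le φ hφ1 hlam D)
  have hpos : 0 < lam + (N₀ + t : ℕ) := by positivity
  have h5 : √((lam + (N₀ + t : ℕ)) ^ d) * ((√(lam ^ d))⁻¹ * η⁻¹) =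
      Real.exp ((d * Real.log ((lam + (N₀ + t : ℕ)) / lam) + 2 * Real.log (1 / η)) / 2) := by
    rw [add_div, Real.exp_add, mul_div_cancel_left₀ _ (two_ne_zero), Real.exp_log (by positivity),
      Real.exp_half, ← Real.log_pow, Real.exp_log (by positivity), div_pow,
      Real.sqrt_div (by positivity)]
    ring
  rw [le_div_iff₀ (by positivity), mul_comm]
  calc _ ≤ √((lam + (N₀ + t : ℕ)) ^ d) * ((√(lam ^ d))⁻¹ * η⁻¹) := by gcongr
    _ ≤ _ := by
      rw [h5]
      exact Real.exp_le_exp.2 (by linarith)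

/-- The ridge confidence bounds of width `β` hold simultaneously in all rounds. -/
lemma runLaw_not_confident_le (hd : 0 < d) (hφ : Measurable φ) (hφ1 : ∀ z, ‖φ z‖ ≤ 1)
    (M : Env X d) (ρ : Policy X A) (alg : OnlineAlg X A N₀) (N₁ : ℕ) {δ : ℝ} (hδ : 0 < δ)
    (hδ1 : δ < 1) :
    runLaw φ M ρ alg N₁ {D | ¬ ∀ (t : ℕ) (ht : t ≤ N₁) (v : EuclideanSpace ℝ (Fin d)),
      |inner ℝ v (ridge φ d (initSeg (Nat.add_le_add_left ht N₀) D)) - inner ℝ v M.θ| ≤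
        confWidth d (N₀ + N₁) δ *
          matNorm (gram φ d (initSeg (Nat.add_le_add_left ht N₀) D))⁻¹ v} ≤
      ENNReal.ofReal δ := by
  have hd0 : (0 : ℝ) < d := by exact_mod_cast hd
  have hd1 : (1 : ℝ) ≤ d := by exact_mod_cast hd
  -- The failure probability is shared by the `N₁ + 1` times `0, …, N₁`; the last one serves the
  -- output policy.
  set η : ℝ := δ / (N₁ + 1) with hη
  have hη0 : 0 < η := by positivity
  set bad : (t : ℕ) → Set (Dataset X A (N₀ + t)) := fun t =>
    {D | d * Real.log ((d + (N₀ + t : ℕ)) / d) + 2 * Real.log (1 / η) <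
      invForm (gram φ d D) (noiseSum φ M.θ D) (noiseSum φ M.θ D)} with hbad
  have hsub : {D | ¬ ∀ (t : ℕ) (ht : t ≤ N₁) (v : EuclideanSpace ℝ (Fin d)),
      |inner ℝ v (ridge φ d (initSeg (Nat.add_le_add_left ht N₀) D)) - inner ℝ v M.θ| ≤
        confWidth d (N₀ + N₁) δ *
          matNorm (gram φ d (initSeg (Nat.add_le_add_left ht N₀) D))⁻¹ v} ⊆
      ⋃ t : Fin (N₁ + 1),
        initSeg (Nat.add_le_add_left (Nat.le_of_lt_succ t.2) N₀) ⁻¹' (bad t) := by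
    intro D hD
    simp only [Set.mem_ofPred_eq] at hD
    push Not at hD
    obtain ⟨t, ht, v, hv⟩ := hD
    refine Set.mem_iUnion.2 ⟨⟨t, Nat.lt_succ_of_le ht⟩, ?_⟩
    by_contra hnb
    simp only [hbad, Set.mem_preimage, Set.mem_ofPred_eq, not_lt] at hnb
    refine hv.not_ge ((abs_inner_ridge_sub_le φ hd0 _ M.θ_le v).trans ?_)
    refine mul_le_mul_of_nonneg_right ?_ (Real.sqrt_nonneg _)
    set L := Real.log ((1 + (N₀ + N₁ : ℕ)) / δ) with hL
    have hN1 : (N₁ : ℝ) ≤ (N₀ + N₁ : ℕ) := by push_cast; linarith [(N₀.cast_nonneg : (0:ℝ) ≤ N₀)]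
    have htN : ((N₀ + t : ℕ) : ℝ) ≤ (N₀ + N₁ : ℕ) := by exact_mod_cast Nat.add_le_add_left ht N₀
    have hL0 : 0 ≤ L := Real.log_nonneg (by rw [le_div_iff₀ hδ]; linarith)
    have hl1 : Real.log ((d + (N₀ + t : ℕ)) / d) ≤ L := by
      refine Real.log_le_log (by positivity) ?_
      calc ((d : ℝ) + (N₀ + t : ℕ)) / d = 1 + (N₀ + t : ℕ) / d := by field_simp
        _ ≤ 1 + (N₀ + N₁ : ℕ) := by
            gcongr
            exact (div_le_self (by positivity) hd1).trans htN
        _ ≤ _ := by rw [le_div_iff₀ hδ]; nlinarith [(N₀ + N₁).cast_nonneg (α := ℝ)]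
    have hl2 : Real.log (1 / η) ≤ L := by
      refine Real.log_le_log (by positivity) ?_
      rw [hη, one_div_div]
      exact div_le_div_of_nonneg_right (by linarith) hδ.le
    -- Both logarithms are at most `L`, and `d L + 2 L ≤ 4 d L`. With `lam = d` the bias is `√d`, so
    -- bias plus noise is at most `√d (1 + 2 √L)`, which is `confWidth`.
    have h1 : √(invForm (gram φ d (initSeg (Nat.add_le_add_left ht N₀) D))
        (noiseSum φ M.θ (initSeg (Nat.add_le_add_left ht N₀) D))
        (noiseSum φ M.θ (initSeg (Nat.add_le_add_left ht N₀) D))) ≤ √(d * (2 ^ 2 * L)) := by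
      refine Real.sqrt_le_sqrt (hnb.trans ?_)
      nlinarith [mul_nonneg (sub_nonneg.2 hd1) hL0, mul_le_mul_of_nonneg_left hl1 hd0.le]
    rw [Real.sqrt_mul hd0.le, Real.sqrt_mul (by norm_num), Real.sqrt_sq (by norm_num)] at h1
    rw [confWidth]
    linarith
  refine (measure_mono hsub).trans ((measure_iUnion_le _).trans ?_)
  rw [tsum_fintype]
  calc ∑ t : Fin (N₁ + 1), runLaw φ M ρ alg N₁
        (initSeg (Nat.add_le_add_left (Nat.le_of_lt_succ t.2) N₀) ⁻¹' (bad t))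
      ≤ ∑ _t : Fin (N₁ + 1), ENNReal.ofReal η := Finset.sum_le_sum fun t _ =>
        (runLaw_preimage_initSeg_le hφ M ρ alg (Nat.le_of_lt_succ t.2) _).trans
          (runLaw_invForm_noiseSum_gt_le hφ hφ1 hd0 M ρ alg t hη0)
    _ = ENNReal.ofReal δ := by
        rw [Finset.sum_const, Finset.card_univ, Fintype.card_fin, nsmul_eq_mul,
          ← ENNReal.ofReal_natCast, ← ENNReal.ofReal_mul (by positivity)]
        congr 1
        rw [hη]; push_cast; field_simp

end Confidence

/-! ### From realized widths to expected widths. -/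

section Concentration

variable {X : Type u} {A : Type v} [MeasurableSpace X] [MeasurableSpace A] {d : ℕ}
  {φ : X × A → EuclideanSpace ℝ (Fin d)} {N₀ : ℕ}

/-- The mean width `E_{x ∼ q, a ∼ π} ‖φ(x,a)‖_{Λ̂⁻¹}`. -/
noncomputable def meanWidth (φ : X × A → EuclideanSpace ℝ (Fin d)) (q : Measure X) (lam : ℝ)
    {n : ℕ} (D : Dataset X A n) (π : Policy X A) : ℝ :=
  ∫ p, matNorm (gram φ lam D)⁻¹ (φ p) ∂(q ⊗ₘ π.1)

/-- The sum over the online rounds of half the mean width minus the realized width. -/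
noncomputable def widthDeviation (φ : X × A → EuclideanSpace ℝ (Fin d)) (q : Measure X) (lam : ℝ)
    (alg : OnlineAlg X A N₀) : (t : ℕ) → Dataset X A (N₀ + t) → ℝ
  | 0, _ => 0
  | t + 1, D =>
    let D' : Dataset X A (N₀ + t) := Fin.init (n := N₀ + t) D
    let o : Obs X A := D (Fin.last (N₀ + t))
    widthDeviation φ q lam alg t D' + (meanWidth φ q lam D' (alg.policy t D') / 2 -
      matNorm (gram φ lam D')⁻¹ (φ (o.1, o.2.1)))

lemma measurable_meanWidth_policy (hφ : Measurable φ) (M : Env X d) (lam : ℝ)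
    (alg : OnlineAlg X A N₀) (t : ℕ) :
    Measurable fun D : Dataset X A (N₀ + t) => meanWidth φ M.q lam D (alg.policy t D) := by
  simp only [meanWidth, ← const_compProd_apply_eq]
  exact (StronglyMeasurable.integral_kernel_prod_right
    (measurable_matNorm_gram hφ lam).stronglyMeasurable).measurable

lemma measurable_widthDeviation (hφ : Measurable φ) (M : Env X d) (lam : ℝ)
    (alg : OnlineAlg X A N₀) (t : ℕ) : Measurable (widthDeviation φ M.q lam alg t) := by
  induction t with
  | zero => exact measurable_const
  | succ t ih =>
    have hi := measurable_init (X := X) (A := A) (n := N₀ + t)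
    have hl : Measurable fun D : Dataset X A (N₀ + t + 1) => D (Fin.last (N₀ + t)) :=
      measurable_pi_apply _
    refine (ih.comp hi).add ((((measurable_meanWidth_policy hφ M lam alg t).comp hi).div_const
      2).sub ?_)
    exact (measurable_matNorm_gram hφ lam).comp
      (hi.prodMk (hl.fst.prodMk hl.snd.fst))

/-- Given the past, the increment is `E[Y] / 2 - Y` with `Y` in `[0, 1]`, so the exponential is a
supermartingale started at one. The range of `Y` uses `1 ≤ lam`. -/
lemma lintegral_exp_widthDeviation_le (hφ : Measurable φ) (hφ1 : ∀ z, ‖φ z‖ ≤ 1) {lam : ℝ}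
    (hlam : 1 ≤ lam) (M : Env X d) (ρ : Policy X A) (alg : OnlineAlg X A N₀) (t : ℕ) :
    ∫⁻ D, ENNReal.ofReal (Real.exp (widthDeviation φ M.q lam alg t D)) ∂(runLaw φ M ρ alg t) ≤
      1 := by
  have hmeas : ∀ t, Measurable fun D : Dataset X A (N₀ + t) =>
      ENNReal.ofReal (Real.exp (widthDeviation φ M.q lam alg t D)) := fun t =>
    (measurable_widthDeviation hφ M lam alg t).exp.ennreal_ofReal
  have := isProbabilityMeasure_offlineLaw hφ M ρ N₀
  refine (lintegral_runLaw_le hφ M ρ alg _ hmeas (fun t D => ?_) t).trans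
    (by simp [widthDeviation])
  have hs : Measurable fun o : Obs X A =>
      (Fin.snoc (α := fun _ => Obs X A) D o : Dataset X A (N₀ + t + 1)) :=
    measurable_snoc.comp (measurable_const.prodMk measurable_id)
  refine (lintegral_episodeLaw hφ M _ ((hmeas (t + 1)).comp hs)).le.trans ?_
  set W := widthDeviation φ M.q lam alg t D with hW
  set m := meanWidth φ M.q lam D (alg.policy t D) with hm
  have e : ∀ p : X × A, ∀ z : ℝ, widthDeviation φ M.q lam alg (t + 1)
      (Fin.snoc (α := fun _ => Obs X A) D (p.1, p.2, inner ℝ (φ p) M.θ + z)) =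
      W + (m / 2 - matNorm (gram φ lam D)⁻¹ (φ p)) := by
    intro p z
    simp [widthDeviation, hW, hm]
  simp only [Function.comp_apply, e, lintegral_const, measure_univ, mul_one, Real.exp_add]
  simp only [ENNReal.ofReal_mul (Real.exp_pos W).le]
  rw [lintegral_const_mul' _ _ ENNReal.ofReal_ne_top]
  refine mul_le_of_le_one_right zero_le ?_
  exact lintegral_exp_half_mean_sub_le
    ((measurable_matNorm_gram hφ lam).comp (measurable_const.prodMk measurable_id))
    (fun _ => Real.sqrt_nonneg _) (fun p => matNorm_gram_le_one φ hlam D (hφ1 p))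

lemma widthDeviation_eq_sum (q : Measure X) (lam : ℝ) (alg : OnlineAlg X A N₀) (N₁ : ℕ)
    (D : Dataset X A (N₀ + N₁)) :
    widthDeviation φ q lam alg N₁ D =
      ∑ t : Fin N₁, (meanWidth φ q lam (past D t) (alg.policy t (past D t)) / 2 -
        matNorm (gram φ lam (past D t))⁻¹
          (φ ((D (Fin.natAdd N₀ t)).1, (D (Fin.natAdd N₀ t)).2.1))) := by
  induction N₁ with
  | zero => simp [widthDeviation]
  | succ N₁ ih =>
    rw [Fin.sum_univ_castSucc]
    exact congrArg₂ (· + ·) (ih _) rfl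

/-- The mean widths of the online rounds are controlled by the realized ones. -/
lemma runLaw_sum_meanWidth_gt_le (hφ : Measurable φ) (hφ1 : ∀ z, ‖φ z‖ ≤ 1) {lam : ℝ}
    (hlam : 1 ≤ lam) (M : Env X d) (ρ : Policy X A) (alg : OnlineAlg X A N₀) (N₁ : ℕ) {δ : ℝ}
    (hδ : 0 < δ) :
    runLaw φ M ρ alg N₁ {D | ¬ ∑ t : Fin N₁,
        meanWidth φ M.q lam (past D t) (alg.policy t (past D t)) ≤
      2 * ∑ t : Fin N₁, matNorm (gram φ lam (past D t))⁻¹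
          (φ ((D (Fin.natAdd N₀ t)).1, (D (Fin.natAdd N₀ t)).2.1)) + 2 * Real.log (1 / δ)} ≤
      ENNReal.ofReal δ := by
  have h1 := mul_meas_ge_le_lintegral (μ := runLaw φ M ρ alg N₁)
    (measurable_widthDeviation hφ M lam alg N₁).exp.ennreal_ofReal (ENNReal.ofReal δ)⁻¹
  have h2 := h1.trans (lintegral_exp_widthDeviation_le hφ hφ1 hlam M ρ alg N₁)
  rw [← ENNReal.div_eq_inv_mul, ENNReal.div_le_iff (by simpa using hδ) ENNReal.ofReal_ne_top,
    one_mul] at h2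
  refine (measure_mono fun D hD => ?_).trans h2
  simp only [Set.mem_ofPred_eq, not_le] at hD ⊢
  rw [← ENNReal.ofReal_inv_of_pos hδ]
  refine ENNReal.ofReal_le_ofReal ?_
  rw [← one_div, ← Real.exp_log (show 0 < 1 / δ by positivity), widthDeviation_eq_sum,
    Finset.sum_sub_distrib, ← Finset.sum_div]
  exact Real.exp_le_exp.2 (by linarith)

end Concentration

/-! ### The elliptical potential. -/

section Potential

variable {X : Type u} {A : Type v} {d : ℕ} (φ : X × A → EuclideanSpace ℝ (Fin d)) {lam : ℝ}

lemma log_det_gram_init (hlam : 0 < lam) {n : ℕ} (D : Dataset X A (n + 1)) :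
    Real.log (gram φ lam D).det = Real.log (gram φ lam (Fin.init D : Dataset X A n)).det +
      Real.log (1 + invForm (gram φ lam (Fin.init D : Dataset X A n))
        (φ ((D (Fin.last n)).1, (D (Fin.last n)).2.1)).ofLp
        (φ ((D (Fin.last n)).1, (D (Fin.last n)).2.1)).ofLp) := by
  have hG := gram_posDef φ hlam (Fin.init D : Dataset X A n)
  have := invForm_self_nonneg hG (φ ((D (Fin.last n)).1, (D (Fin.last n)).2.1)).ofLp
  rw [gram_eq_gram_init, det_add_vecMulVec hG, Real.log_mul hG.det_pos.ne' (by positivity)]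

lemma le_log_det_gram (hlam : 0 < lam) {n : ℕ} (D : Dataset X A n) :
    d * Real.log lam ≤ Real.log (gram φ lam D).det := by
  induction n with
  | zero => simp [gram_zero]
  | succ n ih =>
    rw [log_det_gram_init φ hlam]
    have hG := gram_posDef φ hlam (Fin.init D : Dataset X A n)
    have := invForm_self_nonneg hG (φ ((D (Fin.last n)).1, (D (Fin.last n)).2.1)).ofLp
    have := Real.log_nonneg (le_add_of_nonneg_right this)
    linarith [ih (Fin.init D)]

/-- Elliptical potential. -/
lemma sum_matNorm_sq_le [MeasurableSpace X] [MeasurableSpace A] (hφ1 : ∀ z, ‖φ z‖ ≤ 1)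
    (hlam : 1 ≤ lam) {N₀ N₁ : ℕ} (D : Dataset X A (N₀ + N₁)) :
    ∑ t : Fin N₁, matNorm (gram φ lam (past D t))⁻¹
        (φ ((D (Fin.natAdd N₀ t)).1, (D (Fin.natAdd N₀ t)).2.1)) ^ 2 ≤
      2 * (Real.log (gram φ lam D).det - d * Real.log lam) := by
  have hlam0 : 0 < lam := by positivity
  induction N₁ with
  | zero => simpa using le_log_det_gram φ hlam0 D
  | succ N₁ ih =>
    rw [Fin.sum_univ_castSucc]
    have h1 := ih (Fin.init (n := N₀ + N₁) D)
    have h2 := log_det_gram_init φ hlam0 (n := N₀ + N₁) D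
    set D' : Dataset X A (N₀ + N₁) := Fin.init (n := N₀ + N₁) D
    set v := φ ((D (Fin.last (N₀ + N₁))).1, (D (Fin.last (N₀ + N₁))).2.1) with hv
    have hw0 := invForm_self_nonneg (gram_posDef φ hlam0 D') v.ofLp
    have hw1 := matNorm_gram_le_one φ hlam D' (v := v) (hφ1 _)
    -- On `[0, 1]`, `w ≤ 2 log (1 + w)`, and `log (1 + w)` is the increment of `log det`.
    have h3 : matNorm (gram φ lam D')⁻¹ v ^ 2 ≤ 2 * Real.log (1 + invForm (gram φ lam D')
        v.ofLp v.ofLp) := by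
      rw [matNorm_inv_eq, Real.sqrt_le_one] at hw1
      rw [matNorm_inv_eq, Real.sq_sqrt hw0]
      set w := invForm (gram φ lam D') v.ofLp v.ofLp
      have h4 := Real.one_sub_inv_le_log_of_pos (show 0 < 1 + w by positivity)
      have h5 : w / 2 ≤ 1 - (1 + w)⁻¹ := by
        have : 1 - (1 + w)⁻¹ = w / (1 + w) := by field_simp; ring
        rw [this]
        gcongr
        linarith
      linarith
    refine (add_le_add h1 h3).trans (le_of_eq ?_)
    rw [h2]
    ring

/-- The realized widths of the online rounds add up to `√(d N₁)` up to a logarithm. -/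
lemma sum_matNorm_le [MeasurableSpace X] [MeasurableSpace A] (hφ1 : ∀ z, ‖φ z‖ ≤ 1)
    (hlam : 1 ≤ lam) {N₀ N₁ : ℕ} (D : Dataset X A (N₀ + N₁)) :
    ∑ t : Fin N₁, matNorm (gram φ lam (past D t))⁻¹
        (φ ((D (Fin.natAdd N₀ t)).1, (D (Fin.natAdd N₀ t)).2.1)) ≤
      √(2 * N₁ * d * Real.log ((lam + (N₀ + N₁ : ℕ)) / lam)) := by
  have hlam0 : 0 < lam := by positivity
  refine Real.le_sqrt_of_sq_le ((sq_sum_le_card_mul_sum_sq).trans ?_)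
  have h1 := sum_matNorm_sq_le φ hφ1 hlam D
  have h2 : Real.log (gram φ lam D).det ≤ d * Real.log (lam + (N₀ + N₁ : ℕ)) := by
    rw [← Real.log_pow]
    exact Real.log_le_log (gram_posDef φ hlam0 D).det_pos (det_gram_le φ hφ1 hlam0 D)
  rw [Real.log_div (by positivity) (by positivity), Finset.card_univ, Fintype.card_fin]
  calc _ ≤ (N₁ : ℝ) * (2 * (d * Real.log (lam + (N₀ + N₁ : ℕ)) - d * Real.log lam)) := by
        gcongr
        linarith
    _ = _ := by ring

end Potential

/-! ### The sample mean as a competitor of the near-minimax estimator. -/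

section SampleMean

variable {X : Type u} {A : Type v} [MeasurableSpace X] [MeasurableSpace A] {d : ℕ}
  {φ : X × A → EuclideanSpace ℝ (Fin d)}

lemma abs_inner_feature_le {x θ : EuclideanSpace ℝ (Fin d)} (hx : ‖x‖ ≤ 1) :
    |inner ℝ x θ| ≤ ‖θ‖ :=
  (abs_real_inner_le_norm _ _).trans (mul_le_of_le_one_left (norm_nonneg _) hx)

lemma integrable_inner_feature (hφ : Measurable φ) (hφ1 : ∀ z, ‖φ z‖ ≤ 1)
    (θ : EuclideanSpace ℝ (Fin d)) (μ : Measure (X × A)) [IsFiniteMeasure μ] :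
    Integrable (fun p => (inner ℝ (φ p) θ : ℝ)) μ :=
  Integrable.of_bound (by fun_prop) ‖θ‖
    (Filter.Eventually.of_forall fun p => abs_inner_feature_le (hφ1 p))

/-- The first two moments of the reward of one episode. -/
lemma reward_moments (hφ : Measurable φ) (hφ1 : ∀ z, ‖φ z‖ ≤ 1) (M : Env X d)
    (ρ : Policy X A) :
    MemLp (fun o : Obs X A => o.2.2) 2 (episodeLaw φ M ρ) ∧
      ∫ o, o.2.2 ∂(episodeLaw φ M ρ) = value φ M ρ ∧
      ∫ o, o.2.2 ^ 2 ∂(episodeLaw φ M ρ) ≤ 16 := by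
  have hobs := measurable_observe hφ M.θ
  obtain ⟨hsq, hsq4⟩ := integrable_sq_and_integral_sq_le M.noise_subG
  have hr : Measurable fun o : Obs X A => o.2.2 := by fun_prop
  have hz2 : MemLp (fun z : ℝ => z) 2 M.noise :=
    (memLp_two_iff_integrable_sq (by fun_prop)).2 hsq
  have hz1 : Integrable (fun z : ℝ => z) M.noise := hz2.integrable (by norm_num)
  have hin := integrable_inner_feature hφ hφ1 M.θ (M.q ⊗ₘ ρ.1)
  have hin' : Integrable (fun p : (X × A) × ℝ => (inner ℝ (φ p.1) M.θ : ℝ))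
      ((M.q ⊗ₘ ρ.1).prod M.noise) := hin.comp_fst M.noise
  have hz1' : Integrable (fun p : (X × A) × ℝ => p.2) ((M.q ⊗ₘ ρ.1).prod M.noise) :=
    hz1.comp_snd (M.q ⊗ₘ ρ.1)
  have hsq' : Integrable (fun p : (X × A) × ℝ => p.2 ^ 2) ((M.q ⊗ₘ ρ.1).prod M.noise) :=
    hsq.comp_snd (M.q ⊗ₘ ρ.1)
  have hbd : Integrable (fun p : (X × A) × ℝ => 2 + 2 * p.2 ^ 2)
      ((M.q ⊗ₘ ρ.1).prod M.noise) := (integrable_const _).add (hsq'.const_mul 2)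
  -- The mean of the right side is at most `2 + 2 · 4 = 10`; the stated `16` is a perfect square,
  -- convenient for the root taken later.
  have hpt : ∀ p : (X × A) × ℝ, (observe φ M.θ p).2.2 ^ 2 ≤ 2 + 2 * p.2 ^ 2 := by
    intro p
    have h1 := (abs_inner_feature_le (θ := M.θ) (hφ1 p.1)).trans M.θ_le
    have h2 : (inner ℝ (φ p.1) M.θ : ℝ) ^ 2 ≤ 1 := (sq_le_one_iff_abs_le_one _).2 h1
    simp only [observe]
    nlinarith [sq_nonneg ((inner ℝ (φ p.1) M.θ : ℝ) - p.2)]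
  have hI : Integrable (fun p => (observe φ M.θ p).2.2 ^ 2) ((M.q ⊗ₘ ρ.1).prod M.noise) :=
    hbd.mono' ((hr.comp hobs).pow_const 2).aestronglyMeasurable
      (Filter.Eventually.of_forall fun p => by
        rw [Real.norm_of_nonneg (sq_nonneg _)]; exact hpt p)
  refine ⟨?_, ?_, ?_⟩
  · refine (memLp_two_iff_integrable_sq hr.aestronglyMeasurable).2 ?_
    exact (integrable_map_measure (hr.pow_const 2).aestronglyMeasurable hobs.aemeasurable).2 hI
  · rw [episodeLaw, integral_map hobs.aemeasurable hr.aestronglyMeasurable]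
    simp only [observe]
    rw [integral_add hin' hz1', integral_fun_fst (μ := M.q ⊗ₘ ρ.1) (ν := M.noise)
      (fun p => (inner ℝ (φ p) M.θ : ℝ)), integral_fun_snd (μ := M.q ⊗ₘ ρ.1) (ν := M.noise)
      (fun z => z), M.noise_mean]
    simp [value]
  · rw [episodeLaw, integral_map hobs.aemeasurable (hr.pow_const 2).aestronglyMeasurable]
    refine (integral_mono hI hbd hpt).trans ?_
    rw [integral_add (integrable_const _) (hsq'.const_mul 2), integral_const_mul,
      integral_fun_snd (μ := M.q ⊗ₘ ρ.1) (ν := M.noise) (fun z => z ^ 2)]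
    simp
    linarith

/-- The average reward of an offline dataset. -/
noncomputable def sampleMean (N₀ : ℕ) : Estimator X A N₀ :=
  ⟨fun D => ∑ i, (N₀ : ℝ)⁻¹ * (D i).2.2, by fun_prop⟩

/-- The mean absolute error of a sample mean. -/
lemma integral_abs_sub_sampleMean_le {Ω : Type*} [MeasurableSpace Ω] {μ : Measure Ω}
    [IsProbabilityMeasure μ] {f : Ω → ℝ} (hf : MemLp f 2 μ) {n : ℕ} (hn : 0 < n) :
    Integrable (fun D : Fin n → Ω => |∫ o, f o ∂μ - ∑ i, (n : ℝ)⁻¹ * f (D i)|)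
        (Measure.pi fun _ => μ) ∧
      ∫ D : Fin n → Ω, |∫ o, f o ∂μ - ∑ i, (n : ℝ)⁻¹ * f (D i)| ∂(Measure.pi fun _ => μ) ≤
        √((∫ o, f o ^ 2 ∂μ) / n) := by
  have hn' : (0 : ℝ) < n := by exact_mod_cast hn
  have hgi : ∀ _ : Fin n, MemLp (fun o => (n : ℝ)⁻¹ * f o) 2 μ := fun _ => hf.const_mul _
  have hi : ∀ i : Fin n, MemLp (fun D : Fin n → Ω => (n : ℝ)⁻¹ * f (D i)) 2
      (Measure.pi fun _ => μ) := fun i =>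
    (hgi i).comp_measurePreserving (measurePreserving_eval (fun _ => μ) i)
  set S : (Fin n → Ω) → ℝ := ∑ i, fun D => (n : ℝ)⁻¹ * f (D i) with hS
  have hSa : ∀ D : Fin n → Ω, ∑ i, (n : ℝ)⁻¹ * f (D i) = S D := fun D => by
    rw [hS, Finset.sum_apply]
  simp only [hSa]
  have hS2 : MemLp S 2 (Measure.pi fun _ => μ) := memLp_finsetSum' _ fun i _ => hi i
  have hvar : Var[S; Measure.pi fun _ => μ] ≤ (∫ o, f o ^ 2 ∂μ) / n := by
    have h1 : Var[S; Measure.pi fun _ => μ] = ∑ _i : Fin n, Var[fun o => (n : ℝ)⁻¹ * f o; μ] :=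
      variance_sum_pi (Ω := fun _ : Fin n => Ω) (μ := fun _ => μ)
        (X := fun _ o => (n : ℝ)⁻¹ * f o) hgi
    have h3 : Var[f; μ] ≤ ∫ o, f o ^ 2 ∂μ := variance_le_expectation_sq hf.aestronglyMeasurable
    rw [h1, variance_const_mul, Finset.sum_const, Finset.card_univ, Fintype.card_fin,
      nsmul_eq_mul]
    calc (n : ℝ) * ((n : ℝ)⁻¹ ^ 2 * Var[f; μ])
        ≤ n * ((n : ℝ)⁻¹ ^ 2 * ∫ o, f o ^ 2 ∂μ) := by gcongr
      _ = _ := by field_simp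
  set m := ∫ o, f o ∂μ with hm
  have hES : ∫ D, S D ∂(Measure.pi fun _ => μ) = m := by
    have hint : ∀ i : Fin n, ∫ D : Fin n → Ω, (n : ℝ)⁻¹ * f (D i) ∂(Measure.pi fun _ => μ) =
        (n : ℝ)⁻¹ * m := by
      intro i
      rw [integral_const_mul, integral_comp_eval (μ := fun _ : Fin n => μ) (i := i)
        hf.aestronglyMeasurable]
    simp only [← hSa]
    rw [integral_finsetSum _ fun i _ => (hi i).integrable (by norm_num)]
    simp only [hint, Finset.sum_const, Finset.card_univ, Fintype.card_fin, nsmul_eq_mul]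
    field_simp
  have hd2 : MemLp (fun D => m - S D) 2 (Measure.pi fun _ => μ) := (memLp_const _).sub hS2
  have hY2 : MemLp (fun D => |m - S D|) 2 (Measure.pi fun _ => μ) := hd2.abs
  refine ⟨hY2.integrable (by norm_num), Real.le_sqrt_of_sq_le ?_⟩
  have hYsq : ∫ D, |m - S D| ^ 2 ∂(Measure.pi fun _ => μ) = Var[S; Measure.pi fun _ => μ] := by
    rw [variance_eq_integral hS2.aestronglyMeasurable.aemeasurable, hES]
    refine integral_congr_ae (Filter.Eventually.of_forall fun D => ?_)
    simp only [sq_abs]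
    ring
  -- Nonnegativity of the variance of the absolute error is the inequality between its first and
  -- second moments.
  have h5 := variance_nonneg (fun D => |m - S D|) (Measure.pi fun _ => μ)
  rw [variance_eq_sub hY2] at h5
  simp only [Pi.pow_apply] at h5
  linarith

/-- Under `ρ` the reward is unbiased for the value of `ρ`, and its second moment is bounded
uniformly over environments. -/
lemma worstRisk_sampleMean_le (hφ : Measurable φ) (hφ1 : ∀ z, ‖φ z‖ ≤ 1) (ρ : Policy X A)
    {N₀ : ℕ} (hN : 0 < N₀) :
    worstRisk φ ρ ρ (sampleMean N₀) ≤ ENNReal.ofReal (4 / √N₀) := by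
  refine iSup_le fun M => ?_
  have := isProbabilityMeasure_episodeLaw hφ M ρ
  obtain ⟨h2, hmean, hsq⟩ := reward_moments hφ hφ1 M ρ
  obtain ⟨hint, hle⟩ := integral_abs_sub_sampleMean_le h2 hN
  rw [hmean] at hint hle
  have h3 : risk φ ρ M ρ (sampleMean N₀) = ENNReal.ofReal (∫ D : Dataset X A N₀,
      |value φ M ρ - ∑ i, (N₀ : ℝ)⁻¹ * (D i).2.2| ∂(Measure.pi fun _ => episodeLaw φ M ρ)) :=
    (ofReal_integral_eq_lintegral_ofReal hint
      (Filter.Eventually.of_forall fun _ => abs_nonneg _)).symm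
  rw [h3]
  refine ENNReal.ofReal_le_ofReal (hle.trans ?_)
  calc √((∫ o, o.2.2 ^ 2 ∂(episodeLaw φ M ρ)) / N₀) ≤ √(4 ^ 2 / N₀) := by
        gcongr
        linarith
    _ = 4 / √N₀ := by rw [Real.sqrt_div (by norm_num), Real.sqrt_sq (by norm_num)]

/-- The behavior policy can be evaluated at the parametric rate. -/
lemma uncertaintyLevel_behavior_le (hφ : Measurable φ) (hφ1 : ∀ z, ‖φ z‖ ≤ 1) (ρ : Policy X A)
    {N₀ : ℕ} (hN : 0 < N₀) {κ : ℝ} {alg₀ : Policy X A → Estimator X A N₀}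
    (h : IsMinimax φ ρ κ alg₀) (M : Env X d) :
    uncertaintyLevel φ ρ alg₀ M ρ ≤ ENNReal.ofReal κ * ENNReal.ofReal (4 / √N₀) :=
  (le_iSup (fun M => risk φ ρ M ρ (alg₀ ρ)) M).trans
    ((h ρ (sampleMean N₀)).trans (by gcongr; exact worstRisk_sampleMean_le hφ hφ1 ρ hN))

end SampleMean

/-! ### Mixing two policies. -/

section Mixture

variable {X : Type u} {A : Type v} [MeasurableSpace X] [MeasurableSpace A] {d : ℕ}
  {φ : X × A → EuclideanSpace ℝ (Fin d)}

/-- Tossing a fair coin between two policies. -/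
noncomputable def mixPolicy (π π' : Policy X A) : Policy X A :=
  ⟨⟨fun x => (2⁻¹ : ℝ≥0∞) • (π.1 x + π'.1 x), by
      refine Measure.measurable_of_measurable_coe _ fun s hs => ?_
      simp only [Measure.smul_apply, Measure.add_apply, smul_eq_mul]
      exact ((π.1.measurable_coe hs).add (π'.1.measurable_coe hs)).const_mul _⟩,
    ⟨fun x => ⟨by
      change ((2⁻¹ : ℝ≥0∞) • (π.1 x + π'.1 x)) Set.univ = 1
      simp only [Measure.smul_apply, Measure.add_apply, measure_univ, smul_eq_mul]
      rw [one_add_one_eq_two, ENNReal.inv_mul_cancel two_ne_zero ENNReal.ofNat_ne_top]⟩⟩⟩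

lemma compProd_mixPolicy (q : Measure X) [IsProbabilityMeasure q] (π π' : Policy X A) :
    q ⊗ₘ (mixPolicy π π').1 = (2⁻¹ : ℝ≥0∞) • (q ⊗ₘ π.1 + q ⊗ₘ π'.1) := by
  ext s hs
  rw [Measure.smul_apply, Measure.add_apply, Measure.compProd_apply hs, Measure.compProd_apply hs,
    Measure.compProd_apply hs, ← lintegral_add_left (Kernel.measurable_kernel_prodMk_left hs),
    smul_eq_mul, ← lintegral_const_mul' _ _ (by simp)]
  rfl

lemma value_mixPolicy (hφ : Measurable φ) (hφ1 : ∀ z, ‖φ z‖ ≤ 1) (M : Env X d)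
    (π π' : Policy X A) :
    value φ M (mixPolicy π π') = (value φ M π + value φ M π') / 2 := by
  rw [value, compProd_mixPolicy, integral_smul_measure,
    integral_add_measure (integrable_inner_feature hφ hφ1 _ _)
      (integrable_inner_feature hφ hφ1 _ _)]
  simp [value]
  ring

end Mixture

/-! ### The hybrid rate as the better of the online and offline rates. -/

section Rate

variable {d : ℕ}

/-- The rate `√(1 / (N₀ / C + N₁))` when the online episodes dominate. -/
lemma rate_of_le {C : ℝ≥0∞} {N₀ N₁ : ℕ} (hN : 0 < N₁) (h : (N₀ : ℝ≥0∞) / C ≤ N₁) :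
    ENNReal.ofReal (1 / (2 * √N₁)) ≤ (1 / ((N₀ : ℝ≥0∞) / C + N₁)) ^ (1 / 2 : ℝ) := by
  have hN' : (0 : ℝ) < N₁ := by exact_mod_cast hN
  have h1 : ENNReal.ofReal ((1 / (4 * N₁)) ^ (1 / 2 : ℝ)) ≤
      (1 / ((N₀ : ℝ≥0∞) / C + N₁)) ^ (1 / 2 : ℝ) := by
    rw [← ENNReal.ofReal_rpow_of_pos (by positivity)]
    refine ENNReal.rpow_le_rpow ?_ (by norm_num)
    rw [one_div, ENNReal.ofReal_inv_of_pos (by positivity), one_div]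
    refine ENNReal.inv_le_inv.2 ?_
    calc (N₀ : ℝ≥0∞) / C + N₁ ≤ N₁ + N₁ := by gcongr
      _ = ((2 * N₁ : ℕ) : ℝ≥0∞) := by push_cast; ring
      _ ≤ ENNReal.ofReal (4 * N₁) := by
          rw [← ENNReal.ofReal_natCast]
          refine ENNReal.ofReal_le_ofReal ?_
          push_cast
          linarith
  refine le_trans (ENNReal.ofReal_le_ofReal (le_of_eq ?_)) h1
  rw [← Real.sqrt_eq_rpow, Real.sqrt_div (by norm_num), Real.sqrt_mul (by norm_num),
    Real.sqrt_one, show (4 : ℝ) = 2 ^ 2 by norm_num, Real.sqrt_sq (by norm_num)]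

/-- The rate `√(1 / (N₀ / C + N₁))` when the offline episodes dominate. -/
lemma rate_of_ge {C : ℝ≥0∞} {N₀ N₁ : ℕ} (hN : 0 < N₀) (hC : C ≠ ⊤)
    (h : (N₁ : ℝ≥0∞) ≤ (N₀ : ℝ≥0∞) / C) :
    C ^ (1 / 2 : ℝ) * ENNReal.ofReal (1 / √N₀) ≤
      2 * (1 / ((N₀ : ℝ≥0∞) / C + N₁)) ^ (1 / 2 : ℝ) := by
  have hN' : (0 : ℝ) < N₀ := by exact_mod_cast hN
  have h1 : ENNReal.ofReal (1 / √N₀) = ((N₀ : ℝ≥0∞)⁻¹) ^ (1 / 2 : ℝ) := by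
    rw [← ENNReal.ofReal_natCast, ← ENNReal.ofReal_inv_of_pos hN',
      ENNReal.ofReal_rpow_of_pos (by positivity), ← Real.sqrt_eq_rpow, Real.sqrt_inv, one_div]
  have h2 : (2 : ℝ≥0∞) = 4 ^ (1 / 2 : ℝ) := by
    rw [show (4 : ℝ≥0∞) = 2 ^ (2 : ℝ) by norm_num, ← ENNReal.rpow_mul]
    norm_num
  rw [h1, ← ENNReal.mul_rpow_of_nonneg _ _ (by norm_num)]
  nth_rw 1 [h2]
  rw [← ENNReal.mul_rpow_of_nonneg _ _ (by norm_num)]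
  refine ENNReal.rpow_le_rpow ?_ (by norm_num)
  have hN0 : (N₀ : ℝ≥0∞) ≠ 0 := by exact_mod_cast hN.ne'
  have h3 : C * (N₀ : ℝ≥0∞)⁻¹ = ((N₀ : ℝ≥0∞) / C)⁻¹ := by
    rw [ENNReal.inv_div (Or.inl hC) (Or.inr hN0), div_eq_mul_inv]
  rw [h3, one_div]
  calc ((N₀ : ℝ≥0∞) / C)⁻¹ = 2 * (2 * ((N₀ : ℝ≥0∞) / C))⁻¹ := by
        rw [ENNReal.mul_inv (Or.inl two_ne_zero) (Or.inl ENNReal.ofNat_ne_top), ← mul_assoc,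
          ENNReal.mul_inv_cancel two_ne_zero ENNReal.ofNat_ne_top, one_mul]
    _ ≤ 4 * ((N₀ : ℝ≥0∞) / C + N₁)⁻¹ := by
        gcongr
        · norm_num
        · rw [two_mul]; gcongr

/-- A gap that is small both by the online and by the offline analysis obeys the hybrid rate. -/
lemma le_hybrid_rate {C Uρ e : ℝ≥0∞} {N₀ N₁ : ℕ} (hd : 0 < d) {g κ K a l : ℝ} (hκ : 1 ≤ κ)
    (hK : 0 ≤ K) (ha : 0 ≤ a) (hl : 1 ≤ l)
    (honl : 0 < N₁ → g ≤ 32 * l ^ 2 * d / √N₁)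
    (hoff : 0 < N₀ → C ≠ ⊤ →
      ENNReal.ofReal g ≤ 2 * e + 4 * (ENNReal.ofReal (K * d) * (C ^ (1 / 2 : ℝ) * Uρ)))
    (hU : 0 < N₀ → Uρ ≤ ENNReal.ofReal κ * ENNReal.ofReal (4 / √N₀))
    (he : e ≤ ENNReal.ofReal a * (1 / ((N₀ : ℝ≥0∞) / C + N₁)) ^ (1 / 2 : ℝ)) :
    ENNReal.ofReal g ≤ ENNReal.ofReal (64 * (1 + a + κ * K) * l ^ 2) * d *
      (1 / ((N₀ : ℝ≥0∞) / C + N₁)) ^ (1 / 2 : ℝ) := by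
  have hd1 : (1 : ℝ) ≤ d := by exact_mod_cast hd
  have hκK : 0 ≤ κ * K := by positivity
  have hl2 : 1 ≤ l ^ 2 := one_le_pow₀ hl
  rw [← ENNReal.ofReal_natCast d, ← ENNReal.ofReal_mul (by positivity)]
  rcases le_or_gt ((N₀ : ℝ≥0∞) / C) N₁ with h | h
  · rcases N₁.eq_zero_or_pos with rfl | hN
    -- Here the rate is `1 / 0 = ∞` with a positive coefficient, and nothing is to be proved.
    · have : (N₀ : ℝ≥0∞) / C = 0 := by simpa using h
      rw [this]
      have hpos : ENNReal.ofReal (64 * (1 + a + κ * K) * l ^ 2 * d) ≠ 0 := by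
        rw [Ne, ENNReal.ofReal_eq_zero, not_le]; positivity
      simp [ENNReal.mul_top hpos]
    · refine le_trans ?_ (mul_le_mul_right (rate_of_le hN h) _)
      have hN' : (0 : ℝ) < N₁ := by exact_mod_cast hN
      rw [← ENNReal.ofReal_mul (by positivity)]
      refine ENNReal.ofReal_le_ofReal ((honl hN).trans ?_)
      calc 32 * l ^ 2 * d / √N₁ = 64 * 1 * l ^ 2 * d * (1 / (2 * √N₁)) := by field_simp; norm_num
        _ ≤ _ := by gcongr; linarith
  · have hN : 0 < N₀ := by
      rcases N₀.eq_zero_or_pos with rfl | hN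
      · simp at h
      · exact hN
    have hC : C ≠ ⊤ := by rintro rfl; simp at h
    have h1 := rate_of_ge hN hC h.le
    set r := (1 / ((N₀ : ℝ≥0∞) / C + N₁)) ^ (1 / 2 : ℝ)
    refine (hoff hN hC).trans ?_
    have h4 : ENNReal.ofReal (4 / √N₀) = 4 * ENNReal.ofReal (1 / √N₀) := by
      rw [div_eq_mul_one_div, ENNReal.ofReal_mul (by norm_num)]; simp
    calc 2 * e + 4 * (ENNReal.ofReal (K * d) * (C ^ (1 / 2 : ℝ) * Uρ))
        ≤ 2 * (ENNReal.ofReal a * r) + 4 * (ENNReal.ofReal (K * d) * (C ^ (1 / 2 : ℝ) *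
          (ENNReal.ofReal κ * (4 * ENNReal.ofReal (1 / √N₀))))) := by
          rw [← h4]; gcongr; exact hU hN
      _ = 2 * (ENNReal.ofReal a * r) + 16 * (ENNReal.ofReal (K * d) * ENNReal.ofReal κ) *
          (C ^ (1 / 2 : ℝ) * ENNReal.ofReal (1 / √N₀)) := by ring
      _ ≤ 2 * (ENNReal.ofReal a * r) + 16 * (ENNReal.ofReal (K * d) * ENNReal.ofReal κ) *
          (2 * r) := by gcongr
      _ = ENNReal.ofReal (2 * a + 32 * (K * d * κ)) * r := by
          have hKd : 0 ≤ K * d := by positivity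
          rw [ENNReal.ofReal_add (by positivity) (by positivity),
            ENNReal.ofReal_mul (p := 2) (by norm_num), ENNReal.ofReal_mul (p := 32) (by norm_num),
            ENNReal.ofReal_mul hKd]
          simp only [ENNReal.ofReal_ofNat]
          ring
      _ ≤ _ := by
          gcongr
          have h5 : 0 ≤ κ * K * d := by positivity
          calc 2 * a + 32 * (K * d * κ) ≤ 64 * (1 + a + κ * K) * 1 * d := by nlinarith
            _ ≤ _ := by gcongr

/-- The rate is at least `1/√N` if the concentrability coefficient is at least one. -/
lemma ofReal_le_mul_rate {C : ℝ≥0∞} (hC : 1 ≤ C) {N₀ N₁ : ℕ} {a ε : ℝ} (ha : 0 ≤ a)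
    (h : ε * √((N₀ : ℝ) + N₁) ≤ a) (hN : 0 < N₀ + N₁) :
    ENNReal.ofReal ε ≤ ENNReal.ofReal a * (1 / ((N₀ : ℝ≥0∞) / C + N₁)) ^ (1 / 2 : ℝ) := by
  have hN' : (0 : ℝ) < (N₀ : ℝ) + N₁ := by exact_mod_cast hN
  have h1 : ENNReal.ofReal (1 / √((N₀ : ℝ) + N₁)) ≤
      (1 / ((N₀ : ℝ≥0∞) / C + N₁)) ^ (1 / 2 : ℝ) := by
    rw [one_div, ← Real.sqrt_inv, Real.sqrt_eq_rpow,
      ← ENNReal.ofReal_rpow_of_pos (by positivity), ENNReal.ofReal_inv_of_pos hN',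
      one_div ((N₀ : ℝ≥0∞) / C + N₁)]
    refine ENNReal.rpow_le_rpow (ENNReal.inv_le_inv.2 ?_) (by norm_num)
    rw [ENNReal.ofReal_add (by positivity) (by positivity), ENNReal.ofReal_natCast,
      ENNReal.ofReal_natCast]
    gcongr
    exact ENNReal.div_le_of_le_mul (le_mul_of_one_le_right zero_le hC)
  refine le_trans ?_ (mul_le_mul_right h1 _)
  rw [← ENNReal.ofReal_mul ha]
  refine ENNReal.ofReal_le_ofReal ?_
  rw [mul_one_div, le_div_iff₀ (by positivity)]
  exact h

end Rate

/-! ### From concentrability to uncertainty levels. -/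

section Concentrability

variable {X : Type u} {A : Type v} [MeasurableSpace X] [MeasurableSpace A] {d : ℕ}
  {φ : X × A → EuclideanSpace ℝ (Fin d)}

/-- The finiteness hypotheses settle the degenerate quotients: if `U(ρ) = 0`, a finite `C` forces
`U(π) = 0`, while `U(ρ) = ∞` could hide `U(π)` behind a zero quotient. -/
lemma uncertaintyLevel_le {ρ : Policy X A} {N₀ : ℕ} {alg₀ : Policy X A → Estimator X A N₀}
    {M : Env X d} {π : Policy X A} {C : ℝ≥0∞} (hρ : uncertaintyLevel φ ρ alg₀ M ρ ≠ ⊤)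
    (hC : C ≠ ⊤) (h : concentrability φ ρ alg₀ M π ≤ C) :
    uncertaintyLevel φ ρ alg₀ M π ≤ C ^ (1 / 2 : ℝ) * uncertaintyLevel φ ρ alg₀ M ρ := by
  rw [← ENNReal.div_le_iff_le_mul (Or.inr (ENNReal.rpow_ne_top_of_nonneg (by norm_num) hC))
    (Or.inl hρ)]
  have h1 := ENNReal.rpow_le_rpow h (show (0 : ℝ) ≤ 1 / 2 by norm_num)
  rwa [concentrability, ← ENNReal.rpow_natCast, ← ENNReal.rpow_mul, Nat.cast_ofNat,
    mul_one_div_cancel two_ne_zero, ENNReal.rpow_one] at h1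

lemma concentrability_le_subopt {ρ : Policy X A} {N₀ : ℕ} {alg₀ : Policy X A → Estimator X A N₀}
    {M : Env X d} {πs π : Policy X A} {ε : ℝ} (h : ε < gap φ M πs π) :
    concentrability φ ρ alg₀ M π ≤ concentrabilitySubopt φ ρ alg₀ M πs ε :=
  le_max_of_le_right (le_iSup₂_of_le π (by rw [gap] at h; linarith) le_rfl)

end Concentrability

/-! ### Lin-UCB as an oracle with monotone uncertainty. -/

section Oracle

variable {X : Type u} {A : Type v} [MeasurableSpace X] [MeasurableSpace A] {d : ℕ}
  {φ : X × A → EuclideanSpace ℝ (Fin d)} {lam β : ℝ}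

lemma integrable_matNorm_gram (hφ : Measurable φ) (hφ1 : ∀ z, ‖φ z‖ ≤ 1) (hlam : 1 ≤ lam)
    {n : ℕ} (D : Dataset X A n) (μ : Measure (X × A)) [IsFiniteMeasure μ] :
    Integrable (fun p => matNorm (gram φ lam D)⁻¹ (φ p)) μ :=
  Integrable.of_bound ((measurable_matNorm_gram hφ lam).comp
      (measurable_const.prodMk measurable_id)).aestronglyMeasurable 1
    (Filter.Eventually.of_forall fun p => by
      rw [matNorm_inv_eq, Real.norm_of_nonneg (Real.sqrt_nonneg _)]
      exact matNorm_gram_le_one φ hlam D (hφ1 p))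

lemma uncertainty_eq (q : Measure X) {n : ℕ} (D : Dataset X A n) (π : Policy X A) :
    (linUCB φ q lam β).uncertainty D π = β * meanWidth φ q lam D π :=
  integral_const_mul _ _

lemma uncertainty_initSeg_le (hφ : Measurable φ) (hφ1 : ∀ z, ‖φ z‖ ≤ 1) (hlam : 1 ≤ lam)
    (hβ : 0 ≤ β) (q : Measure X) [IsProbabilityMeasure q] {m n : ℕ} (h : m ≤ n)
    (D : Dataset X A n) (π : Policy X A) :
    (linUCB φ q lam β).uncertainty D π ≤ (linUCB φ q lam β).uncertainty (initSeg h D) π := by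
  rw [uncertainty_eq, uncertainty_eq]
  refine mul_le_mul_of_nonneg_left (integral_mono (integrable_matNorm_gram hφ hφ1 hlam _ _)
    (integrable_matNorm_gram hφ hφ1 hlam _ _) fun p => ?_) hβ
  exact matNorm_gram_initSeg_le φ (by positivity) h D _

/-- Confidence in the ridge estimate gives confidence in all value estimates. -/
lemma abs_estimate_sub_value_le (hφ : Measurable φ) (hφ1 : ∀ z, ‖φ z‖ ≤ 1) (hlam : 1 ≤ lam)
    (M : Env X d) {n : ℕ} (D : Dataset X A n)
    (h : ∀ v : EuclideanSpace ℝ (Fin d), |inner ℝ v (ridge φ lam D) - inner ℝ v M.θ| ≤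
      β * matNorm (gram φ lam D)⁻¹ v) (π : Policy X A) :
    |(linUCB φ M.q lam β).estimate D π - value φ M π| ≤
      (linUCB φ M.q lam β).uncertainty D π := by
  simp only [linUCB, value]
  rw [← integral_sub (integrable_inner_feature hφ hφ1 _ _) (integrable_inner_feature hφ hφ1 _ _)]
  refine (abs_integral_le_integral_abs).trans (integral_mono ?_ ?_ fun p => h (φ p))
  · exact ((integrable_inner_feature hφ hφ1 _ _).sub (integrable_inner_feature hφ hφ1 _ _)).abs
  · exact (integrable_matNorm_gram hφ hφ1 hlam _ _).const_mul β

end Oracle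

/-! ### Optimism and pessimism. -/

section Deterministic

variable {X : Type u} {A : Type v} [MeasurableSpace X] [MeasurableSpace A] {d : ℕ}
  {φ : X × A → EuclideanSpace ℝ (Fin d)} {M : Env X d} {πs : Policy X A} {N₀ N₁ : ℕ}
  {O : Oracle X A} {alg : OnlineAlg X A N₀} {out : Dataset X A (N₀ + N₁) → Policy X A}

/-- The upper bound of the policy played dominates that of `πs`, hence the optimal value, and
exceeds its own value by at most twice its uncertainty. -/
lemma gap_policy_le_of_confident (hopt : IsOptimistic O N₁ alg) (D : Dataset X A (N₀ + N₁))
    (t : Fin N₁) (h : ∀ π, |O.estimate (past D t) π - value φ M π| ≤ O.uncertainty (past D t) π) :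
    gap φ M πs (alg.policy t (past D t)) ≤
      2 * O.uncertainty (past D t) (alg.policy t (past D t)) := by
  have h1 := abs_le.1 (h πs)
  have h2 := abs_le.1 (h (alg.policy t (past D t)))
  have h3 := hopt t t.2 (past D t) πs
  rw [gap]
  linarith [h1.1, h2.2]

/-- The comparator is arbitrary: it will be each policy played, the optimal policy, and a mixture of
the latter with the output. -/
lemma gap_out_le_of_confident (hpes : IsPessimistic O out) (D : Dataset X A (N₀ + N₁))
    (h : ∀ π, |O.estimate D π - value φ M π| ≤ O.uncertainty D π) (π : Policy X A) :
    gap φ M πs (out D) ≤ gap φ M πs π + 2 * O.uncertainty D π := by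
  have h1 := abs_le.1 (h π)
  have h2 := abs_le.1 (h (out D))
  have h3 := hpes D π
  rw [gap, gap]
  linarith [h1.1, h2.2]

end Deterministic

/-- The size of the regret bound, in terms of `l = 1 + log((1 + N)/δ)`. -/
lemma confWidth_mul_le {d N N₁ : ℕ} (hd : 0 < d) (hN₁ : 0 < N₁) {δ l x y : ℝ}
    (hL : 0 ≤ Real.log ((1 + N) / δ)) (hl : l = 1 + Real.log ((1 + N) / δ))
    (hx : x ≤ Real.log ((1 + N) / δ)) (hy : y ≤ Real.log ((1 + N) / δ)) :
    confWidth d N δ * (2 * √(2 * N₁ * d * x) + 2 * y) ≤ 8 * l ^ 2 * d * √N₁ := by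
  set L := Real.log ((1 + N) / δ)
  have hd1 : (1 : ℝ) ≤ d := by exact_mod_cast hd
  have hn1 : (1 : ℝ) ≤ N₁ := by exact_mod_cast hN₁
  -- From `(√L - 1)² ≥ 0`.
  have hsL : 2 * √L ≤ l := by
    rw [hl]; nlinarith [Real.sq_sqrt hL, sq_nonneg (√L - 1)]
  have hl1 : 1 ≤ l := by linarith
  have hsd : 1 ≤ √(d : ℝ) := Real.one_le_sqrt.2 hd1
  have hsn : 1 ≤ √(N₁ : ℝ) := Real.one_le_sqrt.2 hn1
  have hβ : confWidth d N δ ≤ √d * (2 * l) := by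
    rw [confWidth]
    gcongr
    linarith
  have hβ0 : 0 ≤ confWidth d N δ := by rw [confWidth]; positivity
  have h1 : √(2 * N₁ * d * x) ≤ √d * √N₁ * l := by
    calc √(2 * N₁ * d * x) ≤ √((d * N₁) * (2 ^ 2 * L)) := by
          refine Real.sqrt_le_sqrt ?_
          have : 0 ≤ (d : ℝ) * N₁ := by positivity
          nlinarith [mul_le_mul_of_nonneg_left hx this, mul_nonneg this hL]
      _ = √d * √N₁ * (2 * √L) := by
          rw [Real.sqrt_mul (by positivity), Real.sqrt_mul (by positivity),
            Real.sqrt_mul (by positivity), Real.sqrt_sq (by norm_num)]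
      _ ≤ _ := by gcongr
  have h2 : y ≤ √d * √N₁ * l := by
    have : 1 ≤ √(d : ℝ) * √N₁ := one_le_mul_of_one_le_of_one_le hsd hsn
    nlinarith
  calc confWidth d N δ * (2 * √(2 * N₁ * d * x) + 2 * y)
      ≤ confWidth d N δ * (4 * (√d * √N₁ * l)) := by gcongr; linarith
    _ ≤ √d * (2 * l) * (4 * (√d * √N₁ * l)) := by gcongr
    _ = 8 * l ^ 2 * (√d * √d) * √N₁ := by ring
    _ = _ := by rw [Real.mul_self_sqrt (by positivity)]

/-! ### The three bounds on a good run. -/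

section Pathwise

variable {X : Type u} {A : Type v} [MeasurableSpace X] [MeasurableSpace A] {d : ℕ}
  {φ : X × A → EuclideanSpace ℝ (Fin d)}

/-- The three bounds on a run on which the confidence bounds hold, the widths concentrate and the
offline uncertainty is controlled. -/
lemma hybrid_bounds_of_good_run (hd : 0 < d) (hφ : Measurable φ) (hφ1 : ∀ z, ‖φ z‖ ≤ 1)
    {M : Env X d} {ρ πs : Policy X A} (hπs : ∀ π, value φ M π ≤ value φ M πs)
    {N₀ N₁ : ℕ} {δ : ℝ} (hδ : 0 < δ) (hδ1 : δ < 1) {κ : ℝ} (hκ : 1 ≤ κ)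
    {alg₀ : Policy X A → Estimator X A N₀} (halg₀ : IsMinimax φ ρ κ alg₀)
    {O : Oracle X A} (hO : O = linUCB φ M.q d (confWidth d (N₀ + N₁) δ))
    {alg : OnlineAlg X A N₀} (hopt : IsOptimistic O N₁ alg)
    {out : Dataset X A (N₀ + N₁) → Policy X A} (hpes : IsPessimistic O out)
    {K : ℝ} (hK : 0 ≤ K) {a ε : ℝ} (hε : 0 ≤ ε) (hεa : ε * √((N₀ : ℝ) + N₁) ≤ a)
    {l : ℝ} (hl : l = 1 + Real.log ((1 + N₀ + N₁) / δ)) (D : Dataset X A (N₀ + N₁))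
    (hconf : ∀ (t : ℕ) (ht : t ≤ N₁) (v : EuclideanSpace ℝ (Fin d)),
      |inner ℝ v (ridge φ d (initSeg (Nat.add_le_add_left ht N₀) D)) - inner ℝ v M.θ| ≤
        confWidth d (N₀ + N₁) δ *
          matNorm (gram φ d (initSeg (Nat.add_le_add_left ht N₀) D))⁻¹ v)
    (hconc : ∑ t : Fin N₁, meanWidth φ M.q d (past D t) (alg.policy t (past D t)) ≤
      2 * ∑ t : Fin N₁, matNorm (gram φ d (past D t))⁻¹
          (φ ((D (Fin.natAdd N₀ t)).1, (D (Fin.natAdd N₀ t)).2.1)) + 2 * Real.log (1 / δ))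
    (hoff : ∀ π : Policy X A,
      ENNReal.ofReal (O.uncertainty (initSeg (Nat.le_add_right N₀ N₁) D) π) ≤
        ENNReal.ofReal (K * d) * uncertaintyLevel φ ρ alg₀ M π) :
    ENNReal.ofReal (regret φ M πs alg D) ≤
        ENNReal.ofReal (64 * (1 + a + κ * K) * l ^ 2) * d * (N₁ : ENNReal) ^ (1 / 2 : ℝ) *
          (N₁ / (N₀ / concentrabilitySubopt φ ρ alg₀ M πs ε + N₁)) ^ (1 / 2 : ℝ) ∧
      ENNReal.ofReal (gap φ M πs (out D)) ≤
        ENNReal.ofReal (64 * (1 + a + κ * K) * l ^ 2) * d *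
          (1 / (N₀ / concentrability φ ρ alg₀ M πs + N₁)) ^ (1 / 2 : ℝ) ∧
      ENNReal.ofReal (gap φ M πs (out D)) ≤
        ENNReal.ofReal (64 * (1 + a + κ * K) * l ^ 2) * d *
          (1 / (N₀ / concentrabilitySubopt φ ρ alg₀ M πs ε + N₁)) ^ (1 / 2 : ℝ) := by
  have hd1 : (1 : ℝ) ≤ d := by exact_mod_cast hd
  have hd0 : (0 : ℝ) < d := by positivity
  set L := Real.log ((1 + (N₀ + N₁ : ℕ)) / δ) with hL
  have hN0 : (0 : ℝ) ≤ (N₀ + N₁ : ℕ) := by positivity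
  have hL0 : 0 ≤ L := Real.log_nonneg (by rw [le_div_iff₀ hδ]; linarith)
  have hlL : l = 1 + L := by rw [hl, hL]; push_cast; rw [add_assoc]
  have hl1 : 1 ≤ l := by linarith
  have ha : 0 ≤ a := (mul_nonneg hε (Real.sqrt_nonneg _)).trans hεa
  have hβ0 : 0 ≤ confWidth d (N₀ + N₁) δ := by rw [confWidth]; positivity
  have hvalue : ∀ (t : ℕ) (ht : t ≤ N₁) (π : Policy X A),
      |O.estimate (initSeg (Nat.add_le_add_left ht N₀) D) π - value φ M π| ≤
        O.uncertainty (initSeg (Nat.add_le_add_left ht N₀) D) π := fun t ht π => by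
    rw [hO]; exact abs_estimate_sub_value_le hφ hφ1 hd1 M _ (hconf t ht) π
  have hmono : ∀ {m n : ℕ} (h : m ≤ n) (D : Dataset X A n) (π : Policy X A),
      O.uncertainty D π ≤ O.uncertainty (initSeg h D) π := fun h D π => by
    rw [hO]; exact uncertainty_initSeg_le hφ hφ1 hd1 hβ0 M.q h D π
  set u : Fin N₁ → ℝ := fun t => O.uncertainty (past D t) (alg.policy t (past D t)) with hu
  have hgap0 : ∀ π, 0 ≤ gap φ M πs π := fun π => sub_nonneg.2 (hπs π)
  have hgapt : ∀ t : Fin N₁, gap φ M πs (alg.policy t (past D t)) ≤ 2 * u t := fun t =>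
    gap_policy_le_of_confident hopt D t (hvalue t t.2.le)
  have hgapo : ∀ π, gap φ M πs (out D) ≤ gap φ M πs π + 2 * O.uncertainty D π :=
    gap_out_le_of_confident hpes D (hvalue N₁ le_rfl)
  have hsum : 0 < N₁ → ∑ t, u t ≤ 8 * l ^ 2 * d * √N₁ := by
    intro hN
    have h1 : ∑ t, u t = confWidth d (N₀ + N₁) δ *
        ∑ t : Fin N₁, meanWidth φ M.q d (past D t) (alg.policy t (past D t)) := by
      rw [Finset.mul_sum, hu, hO]
      exact Finset.sum_congr rfl fun t _ => uncertainty_eq _ _ _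
    have h2 := sum_matNorm_le φ hφ1 hd1 D
    rw [h1]
    refine le_trans (mul_le_mul_of_nonneg_left (hconc.trans (add_le_add_left
      (mul_le_mul_of_nonneg_left h2 (by norm_num)) _)) hβ0) ?_
    refine confWidth_mul_le hd hN hL0 hlL (Real.log_le_log (by positivity) ?_)
      (Real.log_le_log (by positivity) ?_)
    · calc ((d : ℝ) + (N₀ + N₁ : ℕ)) / d = 1 + (N₀ + N₁ : ℕ) / d := by field_simp
        _ ≤ 1 + (N₀ + N₁ : ℕ) := by
            gcongr
            exact div_le_self hN0 hd1
        _ ≤ _ := by rw [le_div_iff₀ hδ]; nlinarith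
    · exact div_le_div_of_nonneg_right (by linarith) hδ.le
  have honl : 0 < N₁ → gap φ M πs (out D) ≤ 32 * l ^ 2 * d / √N₁ := by
    intro hN
    have hN' : (0 : ℝ) < N₁ := by exact_mod_cast hN
    -- The output is compared with every policy played: `2 u t` for the gap of that policy and `2 u
    -- t` for its final uncertainty, which is at most the one when it was played.
    have h1 : (N₁ : ℝ) * gap φ M πs (out D) ≤ ∑ t, 4 * u t := by
      have h2 : ∑ _t : Fin N₁, gap φ M πs (out D) ≤ ∑ t, 4 * u t := by
        refine Finset.sum_le_sum fun t _ => ?_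
        have h3 := hgapo (alg.policy t (past D t))
        have h4 := hmono (Nat.add_le_add_left t.2.le N₀) D (alg.policy t (past D t))
        have h5 : O.uncertainty D (alg.policy t (past D t)) ≤ u t := h4
        linarith [hgapt t]
      simpa using h2
    rw [← Finset.mul_sum] at h1
    rw [le_div_iff₀ (by positivity)]
    have h6 : √(N₁ : ℝ) * (gap φ M πs (out D) * √N₁) ≤ √(N₁ : ℝ) * (32 * l ^ 2 * d) := by
      calc _ = (√(N₁ : ℝ) * √N₁) * gap φ M πs (out D) := by ring
        _ = N₁ * gap φ M πs (out D) := by rw [Real.mul_self_sqrt hN'.le]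
        _ ≤ 4 * (8 * l ^ 2 * d * √N₁) := h1.trans (by gcongr; exact hsum hN)
        _ = _ := by ring
    exact le_of_mul_le_mul_left h6 (by positivity)
  have hUρ : 0 < N₀ → uncertaintyLevel φ ρ alg₀ M ρ ≤
      ENNReal.ofReal κ * ENNReal.ofReal (4 / √N₀) := fun hN =>
    uncertaintyLevel_behavior_le hφ hφ1 ρ hN halg₀ M
  have hUtop : 0 < N₀ → uncertaintyLevel φ ρ alg₀ M ρ ≠ ⊤ := fun hN =>
    ne_top_of_le_ne_top (ENNReal.mul_ne_top ENNReal.ofReal_ne_top ENNReal.ofReal_ne_top) (hUρ hN)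
  have hunc : ∀ (π : Policy X A) (C : ℝ≥0∞), 0 < N₀ → C ≠ ⊤ →
      concentrability φ ρ alg₀ M π ≤ C →
      ENNReal.ofReal (O.uncertainty (initSeg (Nat.le_add_right N₀ N₁) D) π) ≤
        ENNReal.ofReal (K * d) * (C ^ (1 / 2 : ℝ) * uncertaintyLevel φ ρ alg₀ M ρ) :=
    fun π C hN hC h => (hoff π).trans (by gcongr; exact uncertaintyLevel_le (hUtop hN) hC h)
  set Cε := concentrabilitySubopt φ ρ alg₀ M πs ε with hCε
  have hCε1 : 1 ≤ Cε := le_max_left _ _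
  refine ⟨?_, ?_, ?_⟩
  · rcases N₁.eq_zero_or_pos with rfl | hN
    · simp [regret]
    have hN' : (0 : ℝ) < N₁ := by exact_mod_cast hN
    -- The rate lemma is applied to the average regret per round; multiplying by `N₁ = √N₁ · √N₁`
    -- gives the stated form.
    have key : ENNReal.ofReal (regret φ M πs alg D / N₁) ≤ _ :=
      le_hybrid_rate (C := Cε) (e := ENNReal.ofReal ε) (N₁ := N₁) hd hκ hK ha hl1 ?_ ?_ hUρ
        (ofReal_le_mul_rate hCε1 ha hεa (by omega))
    · have h1 : ENNReal.ofReal (regret φ M πs alg D) =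
          N₁ * ENNReal.ofReal (regret φ M πs alg D / N₁) := by
        rw [← ENNReal.ofReal_natCast, ← ENNReal.ofReal_mul hN'.le, mul_div_cancel₀ _ hN'.ne']
      have h2 : (N₁ : ℝ≥0∞) = (N₁ : ℝ≥0∞) ^ (1 / 2 : ℝ) * (N₁ : ℝ≥0∞) ^ (1 / 2 : ℝ) := by
        rw [← ENNReal.rpow_add_of_nonneg _ _ (by norm_num) (by norm_num)]
        norm_num
      rw [h1, ← mul_one_div (N₁ : ℝ≥0∞), ENNReal.mul_rpow_of_nonneg _ _ (by norm_num)]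
      refine (mul_le_mul_right key _).trans (le_of_eq ?_)
      nth_rw 1 [h2]
      ring
    · intro _
      have h1 : regret φ M πs alg D ≤ 2 * ∑ t, u t := by
        rw [Finset.mul_sum]
        exact Finset.sum_le_sum fun t _ => hgapt t
      rw [div_le_div_iff₀ hN' (by positivity)]
      have h3 : 0 ≤ l ^ 2 * d * N₁ := by positivity
      calc regret φ M πs alg D * √N₁ ≤ (2 * (8 * l ^ 2 * d * √N₁)) * √N₁ := by
            gcongr
            exact h1.trans (by gcongr; exact hsum hN)
        _ = 16 * l ^ 2 * d * (√N₁ * √N₁) := by ring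
        _ = 16 * (l ^ 2 * d * N₁) := by rw [Real.mul_self_sqrt hN'.le]; ring
        _ ≤ 32 * (l ^ 2 * d * N₁) := by gcongr; norm_num
        _ = _ := by ring
    · intro hN₀ hC
      set r := 2 * ENNReal.ofReal ε +
        4 * (ENNReal.ofReal (K * d) * (Cε ^ (1 / 2 : ℝ) * uncertaintyLevel φ ρ alg₀ M ρ))
      -- A round costs at most `ε`, or its policy is among those counted in `Cε` and its uncertainty
      -- is bounded by the offline one.
      have hround : ∀ t : Fin N₁, ENNReal.ofReal (gap φ M πs (alg.policy t (past D t))) ≤ r := by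
        intro t
        rcases le_or_gt (gap φ M πs (alg.policy t (past D t))) ε with h | h
        · refine (ENNReal.ofReal_le_ofReal h).trans (le_add_right ?_)
          exact le_mul_of_one_le_left zero_le one_le_two
        · have h1 := hunc _ Cε hN₀ hC (concentrability_le_subopt (ρ := ρ) (alg₀ := alg₀) h)
          have h2 : u t ≤ O.uncertainty (initSeg (Nat.le_add_right N₀ N₁) D)
              (alg.policy t (past D t)) :=
            hmono (Nat.le_add_right N₀ t) (past D t) (alg.policy t (past D t))
          refine le_add_left ?_
          calc ENNReal.ofReal (gap φ M πs (alg.policy t (past D t)))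
              ≤ ENNReal.ofReal (2 * O.uncertainty (initSeg (Nat.le_add_right N₀ N₁) D)
                (alg.policy t (past D t))) :=
                ENNReal.ofReal_le_ofReal (by linarith [hgapt t])
            _ = 2 * ENNReal.ofReal (O.uncertainty (initSeg (Nat.le_add_right N₀ N₁) D)
                (alg.policy t (past D t))) := by
                rw [ENNReal.ofReal_mul (by norm_num)]; simp
            _ ≤ _ := by
                gcongr
                norm_num
      rw [ENNReal.ofReal_div_of_pos hN', ENNReal.ofReal_natCast]
      refine ENNReal.div_le_of_le_mul' ?_
      rw [regret, ENNReal.ofReal_sum_of_nonneg fun t _ => hgap0 _]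
      refine (Finset.sum_le_sum fun t _ => hround t).trans ?_
      simp
  -- The comparator is `πs`, of gap zero. No `ε` enters, so this coefficient need not be at least
  -- one.
  · refine le_hybrid_rate (e := 0) hd hκ hK ha hl1 honl (fun hN₀ hC => ?_) hUρ zero_le
    have h1 := hunc πs _ hN₀ hC le_rfl
    have h2 := hmono (Nat.le_add_right N₀ N₁) D πs
    have h3 : gap φ M πs πs = 0 := sub_self _
    refine le_add_left ?_
    calc ENNReal.ofReal (gap φ M πs (out D))
        ≤ ENNReal.ofReal (2 * O.uncertainty (initSeg (Nat.le_add_right N₀ N₁) D) πs) :=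
          ENNReal.ofReal_le_ofReal (by linarith [hgapo πs])
      _ = 2 * ENNReal.ofReal (O.uncertainty (initSeg (Nat.le_add_right N₀ N₁) D) πs) := by
          rw [ENNReal.ofReal_mul (by norm_num)]; simp
      _ ≤ _ := by
          gcongr
          norm_num
  -- Without any episode the hypothesis on `ε √N` does not bound `ε`, but the right side is
  -- infinite.
  · rcases (N₀ + N₁).eq_zero_or_pos with h0 | hN
    · obtain ⟨rfl, rfl⟩ : N₀ = 0 ∧ N₁ = 0 := by omega
      exact le_hybrid_rate (e := 0) hd hκ hK ha hl1 honl (fun h => absurd h (lt_irrefl _)) hUρ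
        zero_le
    refine le_hybrid_rate (e := ENNReal.ofReal ε) hd hκ hK ha hl1 honl (fun hN₀ hC => ?_) hUρ
      (ofReal_le_mul_rate hCε1 ha hεa hN)
    -- The threshold is `2 ε` because mixing with `πs` halves the gap, which must still exceed `ε`.
    rcases le_or_gt (gap φ M πs (out D)) (2 * ε) with h | h
    · refine (ENNReal.ofReal_le_ofReal h).trans (le_add_right ?_)
      rw [ENNReal.ofReal_mul (by norm_num)]; simp
    · have hmix : gap φ M πs (mixPolicy πs (out D)) = gap φ M πs (out D) / 2 := by
        rw [gap, gap, value_mixPolicy hφ hφ1]; ring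
      have h1 := hunc _ Cε hN₀ hC (concentrability_le_subopt (ρ := ρ) (alg₀ := alg₀) (ε := ε)
        (π := mixPolicy πs (out D)) (πs := πs) (M := M) (by rw [hmix]; linarith))
      have h2 := hmono (Nat.le_add_right N₀ N₁) D (mixPolicy πs (out D))
      have h3 := hgapo (mixPolicy πs (out D))
      refine le_add_left ?_
      calc ENNReal.ofReal (gap φ M πs (out D))
          ≤ ENNReal.ofReal (4 * O.uncertainty (initSeg (Nat.le_add_right N₀ N₁) D)
            (mixPolicy πs (out D))) :=
            ENNReal.ofReal_le_ofReal (by linarith)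
        _ = 4 * ENNReal.ofReal (O.uncertainty (initSeg (Nat.le_add_right N₀ N₁) D)
            (mixPolicy πs (out D))) := by
            rw [ENNReal.ofReal_mul (by norm_num)]; simp
        _ ≤ _ := by gcongr

end Pathwise

end HybridBandit

/-! ### The union bound over the three bad events. -/

open HybridBandit in
theorem mainTheorem4 :
    -- universal constants: `c` and the power `p` of the logarithm hidden in `Õ`
    ∃ (c : ℝ) (p : ℕ), 0 < c ∧
    ∀ (X : Type*) (A : Type*) [MeasurableSpace X] [MeasurableSpace A] (d : ℕ) (_ : 0 < d)
      (φ : X × A → EuclideanSpace ℝ (Fin d)) (_ : Measurable φ) (_ : ∀ z, ‖φ z‖ ≤ 1)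
      (M : Env X d) (ρ πs : Policy X A) (_ : ∀ π, value φ M π ≤ value φ M πs)
      (N₀ N₁ : ℕ) (δ : ℝ) (_ : 0 < δ) (_ : δ < 1)
      -- the oracle that defines the uncertainty level and the concentrability coefficient
      (κ : ℝ) (_ : 1 ≤ κ) (alg₀ : Policy X A → Estimator X A N₀) (_ : IsMinimax φ ρ κ alg₀)
      -- the hybrid framework with Lin-UCB as its oracle algorithm
      (O : Oracle X A) (_ : O = linUCB φ M.q d (confWidth d (N₀ + N₁) δ))
      (alg : OnlineAlg X A N₀) (_ : IsOptimistic O N₁ alg)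
      (out : Dataset X A (N₀ + N₁) → Policy X A) (_ : IsPessimistic O out)
      -- standing assumption: `Û^π(D₀) ≤ C_Alg U_M(π)` with high probability, `C_Alg = K d`
      (K : ℝ) (_ : 0 ≤ K)
      (_ : offlineLaw φ M ρ N₀ {D | ¬ ∀ π : Policy X A, ENNReal.ofReal (O.uncertainty D π) ≤
        ENNReal.ofReal (K * d) * uncertaintyLevel φ ρ alg₀ M π} ≤ ENNReal.ofReal δ)
      (a ε : ℝ) (_ : 0 ≤ ε) (_ : ε * √((N₀ : ℝ) + N₁) ≤ a)
      (B : ENNReal) (_ : B = ENNReal.ofReal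
        (c * (1 + a + κ * K) * (1 + Real.log ((1 + N₀ + N₁) / δ)) ^ p)),
      runLaw φ M ρ alg N₁ {D | ¬ (
        ENNReal.ofReal (regret φ M πs alg D) ≤
            B * d * (N₁ : ENNReal) ^ (1 / 2 : ℝ) *
              (N₁ / (N₀ / concentrabilitySubopt φ ρ alg₀ M πs ε + N₁)) ^ (1 / 2 : ℝ) ∧
        ENNReal.ofReal (gap φ M πs (out D)) ≤
            B * d * (1 / (N₀ / concentrability φ ρ alg₀ M πs + N₁)) ^ (1 / 2 : ℝ) ∧
        ENNReal.ofReal (gap φ M πs (out D)) ≤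
            B * d * (1 / (N₀ / concentrabilitySubopt φ ρ alg₀ M πs ε + N₁)) ^ (1 / 2 : ℝ))}
        ≤ ENNReal.ofReal (3 * δ) := by
  -- The square of the logarithm comes from the confidence width times the sum of widths, each
  -- contributing one factor `l`.
  refine ⟨64, 2, by norm_num, ?_⟩
  intro X A _ _ d hd φ hφ hφ1 M ρ πs hπs N₀ N₁ δ hδ hδ1 κ hκ alg₀ halg₀ O hO alg hopt out hpes K hK
    hoff a ε hε hεa B hB
  have hd1 : (1 : ℝ) ≤ d := by exact_mod_cast hd
  set E₁ : Set (Dataset X A (N₀ + N₁)) :=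
    {D | ¬ ∀ (t : ℕ) (ht : t ≤ N₁) (v : EuclideanSpace ℝ (Fin d)),
      |inner ℝ v (ridge φ d (initSeg (Nat.add_le_add_left ht N₀) D)) - inner ℝ v M.θ| ≤
        confWidth d (N₀ + N₁) δ *
          matNorm (gram φ d (initSeg (Nat.add_le_add_left ht N₀) D))⁻¹ v}
  set E₂ : Set (Dataset X A (N₀ + N₁)) :=
    {D | ¬ ∑ t : Fin N₁, meanWidth φ M.q d (past D t) (alg.policy t (past D t)) ≤
      2 * ∑ t : Fin N₁, matNorm (gram φ d (past D t))⁻¹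
          (φ ((D (Fin.natAdd N₀ t)).1, (D (Fin.natAdd N₀ t)).2.1)) + 2 * Real.log (1 / δ)}
  set E₃ : Set (Dataset X A (N₀ + N₁)) := initSeg (Nat.le_add_right N₀ N₁) ⁻¹'
    {D | ¬ ∀ π : Policy X A, ENNReal.ofReal (O.uncertainty D π) ≤
      ENNReal.ofReal (K * d) * uncertaintyLevel φ ρ alg₀ M π}
  have h₁ : runLaw φ M ρ alg N₁ E₁ ≤ ENNReal.ofReal δ :=
    runLaw_not_confident_le hd hφ hφ1 M ρ alg N₁ hδ hδ1
  have h₂ : runLaw φ M ρ alg N₁ E₂ ≤ ENNReal.ofReal δ :=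
    runLaw_sum_meanWidth_gt_le hφ hφ1 hd1 M ρ alg N₁ hδ
  have h₃ : runLaw φ M ρ alg N₁ E₃ ≤ ENNReal.ofReal δ :=
    (runLaw_preimage_initSeg_le hφ M ρ alg (Nat.zero_le N₁) _).trans hoff
  calc _ ≤ runLaw φ M ρ alg N₁ ((E₁ ∪ E₂) ∪ E₃) := by
        refine measure_mono fun D hD => ?_
        by_contra hgood
        simp only [Set.mem_union, not_or] at hgood
        obtain ⟨⟨g₁, g₂⟩, g₃⟩ := hgood
        refine hD ?_
        rw [hB]
        exact hybrid_bounds_of_good_run hd hφ hφ1 hπs hδ hδ1 hκ halg₀ hO hopt hpes hK hε hεa rfl D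
          (not_not.1 g₁) (not_not.1 g₂) (not_not.1 g₃)
    _ ≤ ENNReal.ofReal δ + ENNReal.ofReal δ + ENNReal.ofReal δ :=
        (measure_union_le _ _).trans (add_le_add ((measure_union_le _ _).trans
          (add_le_add h₁ h₂)) h₃)
    _ = ENNReal.ofReal (3 * δ) := by
        rw [← ENNReal.ofReal_add hδ.le hδ.le, ← ENNReal.ofReal_add (by positivity) hδ.le]
        congr 1
        ring
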